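/- Let $L\ge 1$ and $E\ge 0$ be integers. Consider loop momenta $\ell_1,\dots,\ell_L$ and external momenta $p_1,\dots,p_E$, write $(q_1,\dots,q_M)=(\ell_1,\dots,\ell_L,p_1,\dots,p_E)$ with $M=L+E$, and let $\Theta$ be the set of unordered pairs $\{i,j\}$ with $1\le i\le L$ and $1\le j\le M$. The scalar products $s_{\{i,j\}}=q_i\cdot q_j$ with $\{i,j\}\in\Theta$ are treated as independent variables. The scalar products of external momenta are complex numbers, which form a symmetric matrix $G=(p_i\cdot p_j)_{i,j}$ with $\det G\neq 0$. Let $$D_a=\sum_{\{i,j\}\in\Theta}\mathcal A_a^{\{i,j\}}s_{\{i,j\}}+\lambda_a,\qquad 1\le a\le N,$$ be denominators with complex coefficients such that $N=|\Theta|$ and the $N\times N$ matrix $\mathcal A$ is invertible (a complete family, including irreducible scalar products). Decompose $$\sum_{a=1}^N x_aD_a=-\sum_{i,j=1}^L\Lambda_{ij}(\ell_i\cdot\ell_j)+\sum_{i=1}^L 2(Q_i\cdot\ell_i)+J$$ with $\Lambda$ symmetric, $Q_i$ linear combinations of the $p_r$, and $J$ free of loop momenta. Let $\mathcal U=\det\Lambda$,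 $\mathcal F=\mathcal U\,(Q^{\intercal}\Lambda^{-1}Q+J)$, and let $\mathcal G=\mathcal U+\mathcal F\in\mathbb C[x_1,\dots,x_N]$ be the Lee–Pomeransky polynomial. The Baikov polynomial $\mathcal P\in\mathbb C[y_1,\dots,y_N]$ is the unique polynomial with $\mathcal P(D_1,\dots,D_N)=\det(q_i\cdot q_j)_{1\le i,j\le M}$. The Bernstein–Sato polynomial of a non-constant $f\in\mathbb C[x_1,\dots,x_N]$ is the monic polynomial $b(s)\in\mathbb C[s]$ of smallest degree for which there is an operator $P(s)\in A^N[s]$ ($A^N$ the Weyl algebra) with $P(s)f^{s+1}=b(s)f^s$ in $\mathbb C[s,x,1/f]\cdot f^s$. If $\deg\mathcal P\le L+1$, then the Bernstein–Sato polynomial $b(s)$ of $\mathcal G$ (exists, is unique and) divides $$(s+1)\prod_{j=2}^{L+1}\Bigl(s+\frac{E+j}{2}\Bigr).$$ In particular, $s+1$ divides $b(s)$, and all roots of $b(s)/(s+1)$ are simple and lie in $\tfrac12\mathbb Z$. Moreover, the hypothesis $\deg\mathcal P\le L+1$ holds automatically if $E=1$ (propagator graphs) or $L=1$ (one-loop graphs).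 -/

import Mathlib

/-!
Part 1: the Weyl algebra, the module `ℂ[s, x, 1/f] · f ^ s` and Bernstein-Sato polynomials.
-/

/-- The defining relations of the Weyl algebra; the generator `Sum.inl i` is the variable `x i`,
the generator `Sum.inr i` is the derivative `∂ i`. -/
inductive WeylRel (K : Type*) [CommRing K] (N : ℕ) :
    FreeAlgebra K (Fin N ⊕ Fin N) → FreeAlgebra K (Fin N ⊕ Fin N) → Prop
  | x_comm (i j : Fin N) : WeylRel K N
      (FreeAlgebra.ι K (Sum.inl i) * FreeAlgebra.ι K (Sum.inl j))
      (FreeAlgebra.ι K (Sum.inl j) * FreeAlgebra.ι K (Sum.inl i))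
  | d_comm (i j : Fin N) : WeylRel K N
      (FreeAlgebra.ι K (Sum.inr i) * FreeAlgebra.ι K (Sum.inr j))
      (FreeAlgebra.ι K (Sum.inr j) * FreeAlgebra.ι K (Sum.inr i))
  | d_x (i j : Fin N) : WeylRel K N
      (FreeAlgebra.ι K (Sum.inr i) * FreeAlgebra.ι K (Sum.inl j))
      (FreeAlgebra.ι K (Sum.inl j) * FreeAlgebra.ι K (Sum.inr i) + if i = j then 1 else 0)

/-- The Weyl algebra in `N` variables with coefficients in `K`. For `K = ℂ[s]` it is the algebra
`A^N[s]` of polynomial differential operators that depend polynomially on the central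
parameter `s`. -/
abbrev WeylAlgebra (K : Type*) [CommRing K] (N : ℕ) : Type _ := RingQuot (WeylRel K N)

namespace BernsteinSato

open Polynomial

section LocDeriv

variable {K R S : Type*} [CommRing K] [CommRing R] [CommRing S] [Algebra K R] [Algebra R S]
  [Algebra K S] [IsScalarTower K R S]

/-- The ring homomorphism `g ↦ g + d(g) ε` from `R` to the dual numbers over `S`. -/
noncomputable def dualHom (S : Type*) [CommRing S] [Algebra R S] (d : Derivation K R R) :
    R →+* TrivSqZeroExt S S where
  toFun g := TrivSqZeroExt.inl (algebraMap R S g) + TrivSqZeroExt.inr (algebraMap R S (d g))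
  map_one' := by ext <;> simp
  map_zero' := by ext <;> simp
  map_add' a b := by ext <;> simp [-DualNumber.inr_eq_smul_eps]
  map_mul' a b := by ext <;> simp [-DualNumber.inr_eq_smul_eps, mul_comm]

theorem isUnit_dualHom {K R S : Type*} [CommRing K] [CommRing R] [CommRing S] [Algebra K R]
    [Algebra R S] (d : Derivation K R R) (f : R) [IsLocalization.Away f S] :
    IsUnit (dualHom S d f) := by
  rw [TrivSqZeroExt.isUnit_iff_isUnit_fst]
  simpa [dualHom] using IsLocalization.Away.algebraMap_isUnit (S := S) f

/-- The extension of `dualHom` to the localization `S = R[1/f]`. -/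
noncomputable def dualLift (S : Type*) [CommRing S] [Algebra R S] (d : Derivation K R R) (f : R)
    [IsLocalization.Away f S] : S →+* TrivSqZeroExt S S :=
  IsLocalization.Away.lift f (g := dualHom S d) (isUnit_dualHom d f)

theorem dualLift_algebraMap {K R S : Type*} [CommRing K] [CommRing R] [CommRing S] [Algebra K R]
    [Algebra R S] (d : Derivation K R R) (f : R) [IsLocalization.Away f S] (g : R) :
    dualLift S d f (algebraMap R S g) = dualHom S d g :=
  IsLocalization.Away.lift_eq f _ g

theorem fst_dualLift {K R S : Type*} [CommRing K] [CommRing R] [CommRing S] [Algebra K R]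
    [Algebra R S] (d : Derivation K R R) (f : R) [IsLocalization.Away f S] (z : S) :
    (dualLift S d f z).fst = z := by
  have h : ((TrivSqZeroExt.fstHom S S S : TrivSqZeroExt S S →+* S).comp (dualLift S d f)) = RingHom.id S := by
    apply IsLocalization.ringHom_ext (Submonoid.powers f)
    ext g
    simp [dualLift_algebraMap, dualHom]
  exact RingHom.congr_fun h z

/-- The unique extension of a derivation `d` of `R` to the localization `S = R[1/f]`
(the quotient rule). -/
noncomputable def locDeriv (S : Type*) [CommRing S] [Algebra R S] [Algebra K S]
    [IsScalarTower K R S] (d : Derivation K R R) (f : R) [IsLocalization.Away f S] :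
    Derivation K S S :=
  Derivation.mk'
    { toFun := fun z => (dualLift S d f z).snd
      map_add' := fun a b => by simp
      map_smul' := fun c a => by
        have h : dualLift S d f (algebraMap K S c) = TrivSqZeroExt.inl (algebraMap K S c) := by
          rw [IsScalarTower.algebraMap_apply K R S, dualLift_algebraMap]
          ext <;> simp [dualHom]
        simp [Algebra.smul_def, h] }
    (fun a b => by simp [fst_dualLift, mul_comm])

theorem locDeriv_algebraMap (d : Derivation K R R) (f : R) [IsLocalization.Away f S] (g : R) :
    locDeriv S d f (algebraMap R S g) = algebraMap R S (d g) := by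
  change (dualLift S d f (algebraMap R S g)).snd = _
  rw [dualLift_algebraMap]
  simp [dualHom, -DualNumber.inr_eq_smul_eps]

/-- Derivations of `R[1/f]` that agree on `R` are equal. -/
theorem derivation_ext {K R S : Type*} [CommRing K] [CommRing R] [CommRing S] [Algebra R S]
    [Algebra K S] (f : R) [IsLocalization.Away f S] (D₁ D₂ : Derivation K S S)
    (h : ∀ g : R, D₁ (algebraMap R S g) = D₂ (algebraMap R S g)) : D₁ = D₂ := by
  ext z
  obtain ⟨⟨g, ⟨_, k, rfl⟩⟩, hz⟩ := IsLocalization.surj (Submonoid.powers f) z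
  have hu : IsUnit (algebraMap R S (f ^ k)) :=
    IsLocalization.map_units S (⟨f ^ k, k, rfl⟩ : Submonoid.powers f)
  have h₁ := congrArg D₁ hz
  have h₂ := congrArg D₂ hz
  simp only [Derivation.leibniz, smul_eq_mul] at h₁ h₂
  rw [h, h g, ← h₂] at h₁
  exact hu.mul_left_cancel (add_left_cancel h₁)

end LocDeriv

/-- The module `ℂ[s, x, 1/f] · f ^ s`: the element `g · f ^ s` is represented by its
coefficient `g`. -/
abbrev PowModule {N : ℕ} (f : MvPolynomial (Fin N) ℂ) : Type :=
  Localization.Away (MvPolynomial.map (Polynomial.C : ℂ →+* ℂ[X]) f)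

/-- The coefficient `g` of `g · f ^ s`, for a polynomial `g` in `ℂ[s, x]`. -/
noncomputable abbrev toPow {N : ℕ} (f : MvPolynomial (Fin N) ℂ) :
    MvPolynomial (Fin N) ℂ[X] →+* PowModule f :=
  algebraMap _ _

/-- The polynomial `f` as an element of `ℂ[s, x, 1/f]`. -/
noncomputable def base {N : ℕ} (f : MvPolynomial (Fin N) ℂ) : PowModule f :=
  toPow f (MvPolynomial.map Polynomial.C f)

/-- The element `1/f` of `ℂ[s, x, 1/f]`. -/
noncomputable def invBase {N : ℕ} (f : MvPolynomial (Fin N) ℂ) : PowModule f :=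
  IsLocalization.Away.invSelf (MvPolynomial.map (Polynomial.C : ℂ →+* ℂ[X]) f)

theorem base_mul_invBase {N : ℕ} (f : MvPolynomial (Fin N) ℂ) : base f * invBase f = 1 :=
  IsLocalization.Away.mul_invSelf _

/-- The partial derivative with respect to `x i` on `ℂ[s, x, 1/f]`. -/
noncomputable def partialDeriv {N : ℕ} (f : MvPolynomial (Fin N) ℂ) (i : Fin N) :
    Derivation ℂ[X] (PowModule f) (PowModule f) :=
  locDeriv (PowModule f) (MvPolynomial.pderiv i) (MvPolynomial.map Polynomial.C f)

/-- The logarithmic derivative `(∂ f / ∂ x i) / f`. -/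
noncomputable def logDeriv {N : ℕ} (f : MvPolynomial (Fin N) ℂ) (i : Fin N) : PowModule f :=
  partialDeriv f i (base f) * invBase f

/-- The action of `x i`, that is `x i · (g · f ^ s) = (x i * g) · f ^ s`. -/
noncomputable def xAct {N : ℕ} (f : MvPolynomial (Fin N) ℂ) (i : Fin N) :
    Module.End ℂ[X] (PowModule f) :=
  LinearMap.mulLeft ℂ[X] (toPow f (MvPolynomial.X i))

/-- The action of `∂ i`, that is
`∂ i · (g · f ^ s) = (∂ g / ∂ x i + s * g * (∂ f / ∂ x i) / f) · f ^ s`. -/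
noncomputable def dAct {N : ℕ} (f : MvPolynomial (Fin N) ℂ) (i : Fin N) :
    Module.End ℂ[X] (PowModule f) :=
  (partialDeriv f i).toLinearMap + (Polynomial.X : ℂ[X]) • LinearMap.mulLeft ℂ[X] (logDeriv f i)

theorem dAct_apply {N : ℕ} (f : MvPolynomial (Fin N) ℂ) (i : Fin N) (g : PowModule f) :
    dAct f i g = partialDeriv f i g + (Polynomial.X : ℂ[X]) • (logDeriv f i * g) := rfl

theorem partialDeriv_comm {N : ℕ} (f : MvPolynomial (Fin N) ℂ) (i j : Fin N) (g : PowModule f) :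
    partialDeriv f i (partialDeriv f j g) = partialDeriv f j (partialDeriv f i g) := by
  have h : ⁅partialDeriv f i, partialDeriv f j⁆ = 0 := by
    apply derivation_ext (MvPolynomial.map (Polynomial.C : ℂ →+* ℂ[X]) f)
    intro p
    have hp : ⁅MvPolynomial.pderiv (R := ℂ[X]) i, MvPolynomial.pderiv (R := ℂ[X]) j⁆ = 0 := by
      apply MvPolynomial.derivation_ext
      intro k
      simp only [Derivation.commutator_apply, MvPolynomial.pderiv_X, Pi.single_apply]
      split_ifs <;> simp
    have hp' := congrArg (fun D : Derivation ℂ[X] (MvPolynomial (Fin N) ℂ[X])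
      (MvPolynomial (Fin N) ℂ[X]) => toPow f (D p)) hp
    simpa [Derivation.commutator_apply, partialDeriv, locDeriv_algebraMap] using hp'
  have h' := congrArg (fun D : Derivation ℂ[X] (PowModule f) (PowModule f) => D g) h
  simpa [Derivation.commutator_apply, sub_eq_zero] using h'

theorem partialDeriv_invBase {N : ℕ} (f : MvPolynomial (Fin N) ℂ) (i : Fin N) :
    partialDeriv f i (invBase f) = - (invBase f ^ 2 * partialDeriv f i (base f)) := by
  have h := congrArg (partialDeriv f i) (base_mul_invBase f)
  simp only [Derivation.leibniz, smul_eq_mul, Derivation.map_one_eq_zero] at h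
  linear_combination (invBase f) * h - partialDeriv f i (invBase f) * base_mul_invBase f

/-- `∂ i` maps `(p / f ^ k) · f ^ s` to
`((f * ∂ p / ∂ x i + (s - k) * p * ∂ f / ∂ x i) / f ^ (k + 1)) · f ^ s`. -/
theorem dAct_frac {N : ℕ} (f : MvPolynomial (Fin N) ℂ) (i : Fin N)
    (p : MvPolynomial (Fin N) (Polynomial ℂ)) (k : ℕ) :
    dAct f i (toPow f p * invBase f ^ k) =
      (base f * toPow f (MvPolynomial.pderiv i p) + (Polynomial.X - (k : Polynomial ℂ)) •
        (toPow f p * toPow f (MvPolynomial.map Polynomial.C (MvPolynomial.pderiv i f))))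
        * invBase f ^ (k + 1) := by
  have hb : partialDeriv f i (base f) =
      toPow f (MvPolynomial.map Polynomial.C (MvPolynomial.pderiv i f)) := by
    simp [partialDeriv, base, locDeriv_algebraMap, MvPolynomial.pderiv_map]
  have hp : partialDeriv f i (toPow f p) = toPow f (MvPolynomial.pderiv i p) := by
    simp [partialDeriv, locDeriv_algebraMap]
  rw [dAct_apply, Derivation.leibniz, Derivation.leibniz_pow, partialDeriv_invBase, logDeriv, hb, hp]
  simp only [smul_eq_mul, Algebra.smul_def, map_sub, map_natCast, nsmul_eq_mul]
  have := base_mul_invBase f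
  cases k with
  | zero => 
    simp
    linear_combination (-toPow f (MvPolynomial.pderiv i p)) * this
  | succ n => 
    simp
    linear_combination (-toPow f (MvPolynomial.pderiv i p)*invBase f^(n+1)) * this

theorem dAct_comm {N : ℕ} (f : MvPolynomial (Fin N) ℂ) (i j : Fin N) :
    dAct f i * dAct f j = dAct f j * dAct f i := by
  ext g
  have hl : partialDeriv f i (logDeriv f j) = partialDeriv f j (logDeriv f i) := by
    simp only [logDeriv, Derivation.leibniz, smul_eq_mul, partialDeriv_invBase,
      partialDeriv_comm f i j (base f)]
    ring
  simp only [Module.End.mul_apply, dAct_apply, map_add, Derivation.map_smul, Derivation.leibniz,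
    smul_eq_mul, hl, partialDeriv_comm f i j g, smul_add, mul_smul_comm]
  rw [mul_left_comm (logDeriv f i) (logDeriv f j) g, mul_comm g]
  abel

/-- The images of the generators of the Weyl algebra. -/
noncomputable def genAct {N : ℕ} (f : MvPolynomial (Fin N) ℂ) :
    Fin N ⊕ Fin N → Module.End ℂ[X] (PowModule f) :=
  Sum.elim (xAct f) (dAct f)

/-- The action of the algebra `A^N[s]` on the module `ℂ[s, x, 1/f] · f ^ s`. -/
noncomputable def act {N : ℕ} (f : MvPolynomial (Fin N) ℂ) :
    WeylAlgebra ℂ[X] N →ₐ[ℂ[X]] Module.End ℂ[X] (PowModule f) :=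
  RingQuot.liftAlgHom ℂ[X] ⟨FreeAlgebra.lift ℂ[X] (genAct f), by
    intro a b hab
    induction hab with
    | x_comm i j =>
      ext g
      simp [genAct, xAct, mul_left_comm]
    | d_comm i j => simpa [genAct] using dAct_comm f i j
    | d_x i j =>
      ext g
      have hX : partialDeriv f i (toPow f (MvPolynomial.X j)) = if i = j then 1 else 0 := by
        simp only [partialDeriv, locDeriv_algebraMap, MvPolynomial.pderiv_X, Pi.single_apply]
        split_ifs <;> simp_all
      split_ifs with hij
      · simp only [hij, if_true] at hX
        simp [genAct, xAct, dAct_apply, hX, hij, mul_add, mul_left_comm (logDeriv f j)]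
        ring
      · simp only [hij, if_false] at hX
        simp [genAct, xAct, dAct_apply, hX, mul_add, mul_left_comm (logDeriv f i)]⟩

/-- `P` is a Bernstein-Sato operator of `f` for the polynomial `b`: the functional equation
`P(s) f ^ (s + 1) = b(s) f ^ s` holds, where `f ^ (s + 1) = f · f ^ s`. -/
def FunctionalEquation {N : ℕ} (f : MvPolynomial (Fin N) ℂ) (P : WeylAlgebra ℂ[X] N)
    (b : ℂ[X]) : Prop :=
  act f P (base f) = b • (1 : PowModule f)

/-- `b` is the Bernstein-Sato polynomial of `f`: the monic polynomial of smallest degree for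
which the functional equation has a solution. -/
structure IsBernsteinSatoPolynomial {N : ℕ} (f : MvPolynomial (Fin N) ℂ) (b : ℂ[X]) : Prop where
  monic : b.Monic
  exists_operator : ∃ P : WeylAlgebra ℂ[X] N, FunctionalEquation f P b
  minimal : ∀ c : ℂ[X], c.Monic → (∃ P : WeylAlgebra ℂ[X] N, FunctionalEquation f P c) →
    b.natDegree ≤ c.natDegree

end BernsteinSato

/-!
Part 2: integral families, Lee-Pomeransky polynomials and Baikov polynomials.
-/

/-- The unordered pairs of momenta that contain a loop momentum. The momenta are labelled by
`Fin L ⊕ Fin E`: `Sum.inl i` is the loop momentum `ℓ i`, `Sum.inr r` the external momentum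
`p r`. -/
abbrev LoopPair (L E : ℕ) : Type :=
  {t : Sym2 (Fin L ⊕ Fin E) // ∃ i : Fin L, Sum.inl i ∈ t}

/-- The pair that consists of the loop momentum `ℓ i` and any momentum `q`. -/
def LoopPair.mk {L E : ℕ} (i : Fin L) (q : Fin L ⊕ Fin E) : LoopPair L E :=
  ⟨s(Sum.inl i, q), i, Sym2.mem_mk_left _ _⟩

/-- An integral family with `L` loop momenta, `E` external momenta and `N` denominators
`D a = ∑ t, coeff a t * s t + const a`, where `s t` is the scalar product of the two momenta of
the pair `t`. The kinematics enters through the Gram matrix of the external momenta. -/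
structure IntegralFamily (L E N : ℕ) where
  gram : Matrix (Fin E) (Fin E) ℂ
  gram_symm : gram.IsSymm
  coeff : Matrix (Fin N) (LoopPair L E) ℂ
  const : Fin N → ℂ

namespace IntegralFamily

open MvPolynomial

variable {L E N : ℕ} (F : IntegralFamily L E N)

/-- A complete family: the coefficient matrix is invertible, so that in particular `N` is the
number of loop-momentum dependent scalar products. -/
def IsComplete : Prop :=
  ∃ B : Matrix (LoopPair L E) (Fin N) ℂ, F.coeff * B = 1 ∧ B * F.coeff = 1

/-- The symmetric `L × L` matrix of (minus) the quadratic part of `∑ a, x a * D a` in the loop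
momenta. -/
noncomputable def loopMatrix : Matrix (Fin L) (Fin L) (MvPolynomial (Fin N) ℂ) :=
  fun i j => - ∑ a, C ((if i = j then 1 else 1 / 2) * F.coeff a (.mk i (.inl j))) * X a

/-- The linear part of `∑ a, x a * D a` is `∑ i, 2 * (Q i · ℓ i)` with the linear combination
`Q i = ∑ r, linearPart i r * p r` of external momenta. -/
noncomputable def linearPart : Matrix (Fin L) (Fin E) (MvPolynomial (Fin N) ℂ) :=
  fun i r => ∑ a, C (1 / 2 * F.coeff a (.mk i (.inr r))) * X a

/-- The scalar products `Q i · Q j`. -/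
noncomputable def linearGram : Matrix (Fin L) (Fin L) (MvPolynomial (Fin N) ℂ) :=
  F.linearPart * (F.gram.map C : Matrix _ _ (MvPolynomial (Fin N) ℂ)) * F.linearPart.transpose

/-- The part of `∑ a, x a * D a` that is constant in the loop momenta. -/
noncomputable def constPart : MvPolynomial (Fin N) ℂ := ∑ a, C (F.const a) * X a

/-- The polynomial `𝓤 = det Λ`. -/
noncomputable def symanzikU : MvPolynomial (Fin N) ℂ := F.loopMatrix.det

/-- The polynomial `𝓕 = 𝓤 * (Qᵀ Λ⁻¹ Q + J)`, where `𝓤 * Λ⁻¹` is the adjugate of `Λ`. -/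
noncomputable def symanzikF : MvPolynomial (Fin N) ℂ :=
  (∑ i, ∑ j, F.loopMatrix.adjugate i j * F.linearGram i j) + F.symanzikU * F.constPart

/-- The Lee-Pomeransky polynomial `𝓖 = 𝓤 + 𝓕`. -/
noncomputable def leePomeransky : MvPolynomial (Fin N) ℂ := F.symanzikU + F.symanzikF

/-- The scalar products of the momenta: an independent variable for each pair that contains a
loop momentum, and a number for a pair of external momenta. -/
noncomputable def scalarProduct :
    Matrix (Fin L ⊕ Fin E) (Fin L ⊕ Fin E) (MvPolynomial (LoopPair L E) ℂ)
  | .inl i, q => X (.mk i q)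
  | .inr r, .inl i => X (.mk i (.inr r))
  | .inr r, .inr t => C (F.gram r t)

/-- The denominators as polynomials in the loop-momentum dependent scalar products. -/
noncomputable def denominator (a : Fin N) : MvPolynomial (LoopPair L E) ℂ :=
  ∑ t, C (F.coeff a t) * X t + C (F.const a)

/-- A sum over pairs as a sum over ordered pairs; `{i, j}` with `i ≠ j` is met twice. -/
theorem sum_loopPair {M : Type*} [AddCommGroup M] [Module ℂ M] (h : LoopPair L E → M) :
    ∑ t, h t = (∑ i, ∑ j, (if i = j then 1 else 1/2 : ℂ) • h (.mk i (.inl j))) +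
      ∑ i, ∑ r, h (.mk i (.inr r)) := by
  let w : Fin L × (Fin L ⊕ Fin E) → ℂ :=
    fun p => Sum.elim (fun j => if p.1 = j then 1 else 1 / 2) (fun _ => 1) p.2
  let m : Fin L × (Fin L ⊕ Fin E) → LoopPair L E := fun p => .mk p.1 p.2
  have hw : ∀ t, ∑ p with m p = t, w p = 1 := by
    rintro ⟨t, i, ht⟩
    obtain ⟨q, rfl⟩ := ht
    rcases q with j | r
    · change ∑ p with m p = LoopPair.mk i (.inl j), w p = 1
      have : (Finset.univ.filter fun p => m p = LoopPair.mk i (.inl j)) =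
          {(i, .inl j), (j, .inl i)} := by
        ext ⟨k, q⟩
        simp [m, LoopPair.mk]
      rw [this]
      by_cases hij : i = j
      · subst hij
        simp [w]
      · rw [Finset.sum_pair (by simp [hij])]
        simp [w, hij, Ne.symm hij]
        norm_num
    · change ∑ p with m p = LoopPair.mk i (.inr r), w p = 1
      have : (Finset.univ.filter fun p => m p = LoopPair.mk i (.inr r)) =
          {(i, .inr r)} := by
        ext ⟨k, q⟩
        simp [m, LoopPair.mk]
      simp [this, w]
  have hs : ∑ p, w p • h (m p) = ∑ t, h t := by
    rw [← Finset.sum_fiberwise Finset.univ m]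
    refine Finset.sum_congr rfl fun t _ => ?_
    rw [Finset.sum_congr rfl (g := fun p => w p • h t)
      (fun p hp => by rw [(Finset.mem_filter.mp hp).2]), ← Finset.sum_smul, hw, one_smul]
  rw [← hs, Fintype.sum_prod_type]
  simp [Fintype.sum_sum_type, Finset.sum_add_distrib, w, m]

/-- The decomposition of `∑ a, x a * D a` into its quadratic, linear and constant parts in the
loop momenta. -/
theorem decomposition (x : Fin N → ℂ) : ∑ a, C (x a) * F.denominator a =
    - ∑ i, ∑ j, C (eval x (F.loopMatrix i j)) * F.scalarProduct (.inl i) (.inl j)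
    + ∑ i, 2 * ∑ r, C (eval x (F.linearPart i r)) * F.scalarProduct (.inl i) (.inr r)
    + C (eval x F.constPart) := by
  have h (a : Fin N) := sum_loopPair (fun t => C (F.coeff a t) * X t : LoopPair L E → MvPolynomial (LoopPair L E) ℂ)
  have h2 : (2 : MvPolynomial (LoopPair L E) ℂ) = C 2 := (map_ofNat C 2).symm
  simp only [denominator, h, scalarProduct, loopMatrix, linearPart, constPart, map_neg, map_sum, map_mul, eval_C, eval_X, neg_mul, Finset.sum_neg_distrib, neg_neg, mul_add, Finset.sum_add_distrib, Finset.sum_mul, Finset.mul_sum, smul_eq_C_mul, h2]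
  congr 1
  · congr 1
    · rw [Finset.sum_comm]; refine Finset.sum_congr rfl fun i _ => ?_
      rw [Finset.sum_comm]; refine Finset.sum_congr rfl fun j _ => ?_
      refine Finset.sum_congr rfl fun a _ => by ring
    · rw [Finset.sum_comm]; refine Finset.sum_congr rfl fun i _ => ?_
      rw [Finset.sum_comm]; refine Finset.sum_congr rfl fun j _ => ?_
      refine Finset.sum_congr rfl fun a _ => ?_
      have : (C 2 * C (1/2) : MvPolynomial (LoopPair L E) ℂ) = 1 := by rw [← C_mul]; norm_num
      linear_combination (- C (x a) * C (F.coeff a (.mk i (.inr j))) * X (LoopPair.mk i (.inr j))) * this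
  · refine Finset.sum_congr rfl fun a _ => by ring

/-- `P` is the Baikov polynomial: `P (D 1, …, D N)` is the Gram determinant of all momenta. -/
def IsBaikovPolynomial (P : MvPolynomial (Fin N) ℂ) : Prop :=
  aeval F.denominator P = F.scalarProduct.det

/-- A complete family has exactly one Baikov polynomial. -/
theorem existsUnique_isBaikovPolynomial (hF : F.IsComplete) :
    ∃! P : MvPolynomial (Fin N) ℂ, F.IsBaikovPolynomial P := by
  obtain ⟨B, hAB, hBA⟩ := hF
  let ψ : MvPolynomial (LoopPair L E) ℂ →ₐ[ℂ] MvPolynomial (Fin N) ℂ :=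
    aeval fun t => ∑ a, C (B t a) * (X a - C (F.const a))
  have h1 : (aeval F.denominator).comp ψ = AlgHom.id ℂ _ := by
    apply MvPolynomial.algHom_ext
    intro t
    have : ∀ u, ∑ a, B t a * F.coeff a u = if t = u then 1 else 0 := fun u => by
      rw [← Matrix.mul_apply, hBA, Matrix.one_apply]
    simp only [ψ, denominator, AlgHom.comp_apply, aeval_X, map_sum, map_mul, map_sub, aeval_C,
      MvPolynomial.algebraMap_eq, add_sub_cancel_right, Finset.mul_sum, AlgHom.id_apply]
    rw [Finset.sum_comm]
    simp only [← mul_assoc, ← C_mul, ← Finset.sum_mul, ← map_sum, this]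
    simp
  have h2 : ψ.comp (aeval F.denominator) = AlgHom.id ℂ _ := by
    apply MvPolynomial.algHom_ext
    intro a
    have : ∀ c, ∑ t, F.coeff a t * B t c = if a = c then 1 else 0 := fun c => by
      rw [← Matrix.mul_apply, hAB, Matrix.one_apply]
    simp only [ψ, denominator, AlgHom.comp_apply, aeval_X, map_add, map_sum, map_mul, aeval_C,
      MvPolynomial.algebraMap_eq, Finset.mul_sum, AlgHom.id_apply]
    rw [Finset.sum_comm]
    simp only [← mul_assoc, ← C_mul, ← Finset.sum_mul, ← map_sum, this]
    simp
  refine ⟨ψ F.scalarProduct.det, ?_, ?_⟩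
  · exact congrArg (fun φ => φ F.scalarProduct.det) h1
  · intro P hP
    have h := congrArg (fun φ => φ P) h2
    simp only [AlgHom.comp_apply, AlgHom.id_apply] at h
    rw [← h]
    exact congrArg ψ hP

end IntegralFamily

/-! Add a variable `y` and put `H = y 𝓤 + 𝓕`. It is homogeneous of degree `L + 1`, becomes `𝓖` at `y
= 1`, and factors as `H = 𝓤 z` with `z = y + J + Qᵀ Λ⁻¹ Q`. The operator that lowers powers of `H`
is the Baikov polynomial itself, homogenized to degree `L + 1`, with `∂/∂x_a` in place of `D_a` and
`∂/∂y` as homogenizing variable. The bound `deg 𝓟 ≤ L + 1` makes this a polynomial operator.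

Completeness recombines the derivatives into derivations `σ_ij`, `τ_ir` dual to the entries of `Λ`
and `Q`. A Schur complement in the Gram determinant shows that `∂_y ^ L` times the operator equals
`∂_y · det G · det b` with `b_ij = ∂_y σ_ij - τ_i G⁻¹ τ_j` (`homogenization_baikov`). Since `σ_ij z
= (τ_i z) G⁻¹ (τ_j z)`, the second-order terms cancel: on `h 𝓤 ^ a z ^ m / m!`, with `h` built from
the entries of `Λ⁻¹`, `b_ij` lowers `m` by one and acts on `h` as `σ_ij - (a + E/2) (Λ⁻¹)_ij`
(`heat_apply`). A Cayley identity for minors of `Λ⁻¹` (`cayley_minor`) then evaluates `det b`, with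
one factor `-(a + E/2 + j/2)` for each `0 ≤ j < L`. Taking `a = n + 1` gives the functional equation
for `H ^ (n + 1)` at every natural `n` (`pderivOp_homLeePomeransky_pow`).

At `y = 1`, Euler's relation replaces `∂_y` by the degree minus the Euler operator, with
coefficients polynomial in `n`. An identity at all natural `n` is an identity in `s`, so the stated
product admits a functional equation and `b` divides it. The factor `s + 1` of `b` comes from
setting `s = -1`, because `𝓖` vanishes at the origin. The other roots are simple because the numbers
`(E + j) / 2` are distinct. -/

/-! ### Polynomials in commuting operators. -/

section CommAeval

variable {σ R A : Type*} [CommRing R] [Ring A] [Algebra R A]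

open scoped IsMulCommutative in
/-- Evaluation of a polynomial at a family of commuting elements of a noncommutative algebra. -/
noncomputable def commAeval (T : σ → A) (hT : ∀ i j, T i * T j = T j * T i) :
    MvPolynomial σ R →ₐ[R] A :=
  haveI := Algebra.isMulCommutative_adjoin R (s := Set.range T)
    (by rintro _ ⟨i, rfl⟩ _ ⟨j, rfl⟩; exact hT i j)
  (Algebra.adjoin R (Set.range T)).val.comp
    (MvPolynomial.aeval (S₁ := Algebra.adjoin R (Set.range T)) fun i => ⟨T i, Algebra.subset_adjoin ⟨i, rfl⟩⟩)

open scoped IsMulCommutative in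
theorem commAeval_X (T : σ → A) (hT : ∀ i j, T i * T j = T j * T i) (i : σ) :
    commAeval (R := R) T hT (MvPolynomial.X i) = T i := by
  simp [commAeval]

end CommAeval

/-! ### A Cayley identity for minors of a symmetric matrix. -/

section Cayley

open Matrix

variable {K R : Type*} [CommRing K] [CommRing R] [Algebra K R]

theorem Derivation.map_finset_prod {ι : Type*} [DecidableEq ι] (D : Derivation K R R)
    (s : Finset ι) (f : ι → R) :
    D (∏ i ∈ s, f i) = ∑ i ∈ s, ∏ j ∈ s, if j = i then D (f j) else f j := by
  induction s using Finset.induction_on with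
  | empty => simp
  | insert a s ha ih =>
    rw [Finset.prod_insert ha, Derivation.leibniz, ih, Finset.sum_insert ha, Finset.prod_insert ha,
      if_pos rfl, smul_eq_mul, smul_eq_mul, add_comm, mul_comm _ (D (f a)), Finset.mul_sum]
    congr 1
    · congr 1
      refine Finset.prod_congr rfl fun j hj => ?_
      rw [if_neg (fun h : j = a => ha (h ▸ hj))]
    · refine Finset.sum_congr rfl fun i hi => ?_
      rw [Finset.prod_insert ha, if_neg (fun h : a = i => ha (h ▸ hi))]

theorem Derivation.map_det {n : Type*} [Fintype n] [DecidableEq n] (D : Derivation K R R)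
    (M : Matrix n n R) : D M.det = ∑ p, (M.updateRow p fun q => D (M p q)).det := by
  -- After transposing, the product in the Leibniz formula runs over rows, so the product rule
  -- differentiates one row at a time.
  simp only [← Matrix.det_transpose M, ← Matrix.det_transpose (M.updateRow _ _),
    Matrix.det_apply, map_sum]
  rw [Finset.sum_comm]
  refine Finset.sum_congr rfl fun τ _ => ?_
  rw [← Finset.smul_sum, Units.smul_def, Units.smul_def, map_zsmul, Derivation.map_finset_prod]
  congr 1
  refine Finset.sum_congr rfl fun p _ => Finset.prod_congr rfl fun q _ => ?_
  by_cases h : q = p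
  · subst h; simp
  · simp [Matrix.updateRow_apply, h]

/-- The matrix `W` with an additional first row `a`. -/
def consRow {k : ℕ} (a : Fin (k + 1) → R) (W : Matrix (Fin k) (Fin (k + 1)) R) :
    Matrix (Fin (k + 1)) (Fin (k + 1)) R :=
  Matrix.of fun i j => Fin.cases (a j) (fun i' => W i' j) i

theorem consRow_zero {R : Type*} {k : ℕ} (a : Fin (k + 1) → R) (W : Matrix (Fin k) (Fin (k + 1)) R)
    (j : Fin (k + 1)) : consRow a W 0 j = a j := rfl

theorem consRow_succ {R : Type*} {k : ℕ} (a : Fin (k + 1) → R) (W : Matrix (Fin k) (Fin (k + 1)) R)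
    (i : Fin k) (j : Fin (k + 1)) : consRow a W i.succ j = W i j := rfl

/-- Laplace expansion along the first row for a matrix whose row `p.succ` is replaced by `b` and
whose first row is replaced by `a`. -/
theorem sum_det_updateRow {k : ℕ} (W : Matrix (Fin k) (Fin (k + 1)) R) (p : Fin k)
    (a b : Fin (k + 1) → R) :
    ∑ l : Fin (k + 1), (-1) ^ (l : ℕ) * a l *
        ((W.submatrix id l.succAbove).updateRow p fun q => b (l.succAbove q)).det =
      (consRow a (W.updateRow p b)).det := by
  rw [Matrix.det_succ_row_zero]
  refine Finset.sum_congr rfl fun l _ => ?_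
  congr 2
  ext i j
  by_cases h : i = p
  · subst h; simp [consRow_succ]
  · simp [consRow_succ, Matrix.updateRow_apply, h]

/-- This antisymmetry kills contractions with a symmetric matrix, and it supplies the minus sign in
`sum_derivation_minor`. -/
theorem det_cons_updateRow_swap {k : ℕ} (W : Matrix (Fin k) (Fin (k + 1)) R) (p : Fin k)
    (a b : Fin (k + 1) → R) :
    (consRow a (W.updateRow p b)).det =
      -(consRow b (W.updateRow p a)).det := by
  have h := Matrix.det_permute (Equiv.swap 0 p.succ)
    (consRow b (W.updateRow p a))
  rw [Equiv.Perm.sign_swap (Fin.succ_ne_zero p).symm] at h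
  simp only [Units.val_neg, Units.val_one, Int.cast_neg, Int.cast_one, neg_mul, one_mul] at h
  rw [← h]
  congr 1
  ext i j
  refine Fin.cases ?_ (fun i => ?_) i
  · simp [consRow_zero, consRow_succ]
  · by_cases hi : i = p
    · subst hi; simp [consRow_zero, consRow_succ]
    · rw [Matrix.submatrix_apply, Equiv.swap_apply_of_ne_of_ne (Fin.succ_ne_zero i)
        (fun h => hi (Fin.succ_injective _ h))]
      simp [consRow_succ, Matrix.updateRow_apply, hi]

/-- The contraction of an alternating form with a symmetric matrix vanishes. -/
theorem sum_det_updateRow_symm [Algebra ℂ R] {k : ℕ} (W : Matrix (Fin k) (Fin (k + 1)) R)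
    (p : Fin k) (Y : Matrix (Fin (k + 1)) (Fin (k + 1)) R) (hY : Y.IsSymm) :
    ∑ l : Fin (k + 1), (-1) ^ (l : ℕ) *
      ((W.submatrix id l.succAbove).updateRow p fun q => Y l (l.succAbove q)).det = 0 := by
  -- The sum is `∑ Y l m * B e_l e_m` with `B` antisymmetric and `Y` symmetric, hence equal to its
  -- own negative.
  let B : (Fin (k + 1) → R) → (Fin (k + 1) → R) → R := fun a b =>
    (consRow a (W.updateRow p b)).det
  have hlin : ∀ l : Fin (k + 1), (-1) ^ (l : ℕ) *
      ((W.submatrix id l.succAbove).updateRow p fun q => Y l (l.succAbove q)).det =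
      ∑ m, Y l m * B (Pi.single l 1) (Pi.single m 1) := by
    intro l
    have h1 : ∀ b, B (Pi.single l 1) b = (-1) ^ (l : ℕ) *
        ((W.submatrix id l.succAbove).updateRow p fun q => b (l.succAbove q)).det := by
      intro b
      simp only [B]
      rw [← sum_det_updateRow, Finset.sum_eq_single l]
      · simp
      · intro m _ hm; simp [hm]
      · simp
    simp only [h1]
    have h2 : (fun q => Y l (l.succAbove q)) =
        ∑ m, Y l m • fun q => (Pi.single m 1 : Fin (k + 1) → R) (l.succAbove q) := by
      ext q
      simp [Finset.sum_apply, Pi.single_apply]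
    rw [h2]
    have h3 := map_sum ((Matrix.detRowAlternating (R := R)).toMultilinearMap.toLinearMap
      (W.submatrix id l.succAbove) p)
      (fun m => Y l m • fun q => (Pi.single m 1 : Fin (k + 1) → R) (l.succAbove q)) Finset.univ
    simp only [map_smul, smul_eq_mul] at h3
    change ((W.submatrix id l.succAbove).updateRow p _).det = ∑ m, Y l m *
      ((W.submatrix id l.succAbove).updateRow p _).det at h3
    rw [h3, Finset.mul_sum]
    refine Finset.sum_congr rfl fun m _ => by ring
  have hS : ∑ l, ∑ m, Y l m * B (Pi.single l 1) (Pi.single m 1) =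
      -∑ l, ∑ m, Y l m * B (Pi.single l 1) (Pi.single m 1) := by
    conv_lhs => rw [Finset.sum_comm]
    rw [← Finset.sum_neg_distrib]
    refine Finset.sum_congr rfl fun l _ => ?_
    rw [← Finset.sum_neg_distrib]
    refine Finset.sum_congr rfl fun m _ => ?_
    have h := det_cons_updateRow_swap W p (Pi.single m 1) (Pi.single l 1)
    change B _ _ = - B _ _ at h
    rw [h, hY.apply]; ring
  simp only [hlin]
  set S := ∑ l, ∑ m, Y l m * B (Pi.single l 1) (Pi.single m 1)
  have h2 : (2 : ℂ) • S = 0 := by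
    rw [two_smul]; nth_rw 1 [hS]; simp
  calc S = (1 / 2 : ℂ) • ((2 : ℂ) • S) := by rw [smul_smul]; norm_num
    _ = 0 := by rw [h2, smul_zero]

variable {ι O : Type*} [CommRing O] [Algebra ℂ O] [Algebra ℂ R]

/-- Differentiating row `p` of the minor gives two terms. The one with `Y (c l) (c q)` is a
symmetric contraction and vanishes on summing over `l`. The other is a Laplace expansion of the full
determinant with rows `0` and `p.succ` interchanged, worth `-1/2` of it. There are `k` rows. -/
theorem sum_derivation_minor (d : ι → ι → Derivation ℂ R R) (Y : Matrix ι ι R)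
    (hY : Y.IsSymm)
    (hd : ∀ i j k l, d i j (Y k l) = (1 / 2 : ℂ) • (Y k i * Y j l + Y k j * Y i l))
    {k : ℕ} (r c : Fin (k + 1) → ι) :
    ∑ l : Fin (k + 1), (-1) ^ (l : ℕ) *
      d (r 0) (c l) ((Y.submatrix r c).submatrix Fin.succ l.succAbove).det =
      -(((k : ℂ) / 2) • (Y.submatrix r c).det) := by
  let W : Matrix (Fin k) (Fin (k + 1)) R := (Y.submatrix r c).submatrix Fin.succ id
  have hdet : ∀ l : Fin (k + 1),
      d (r 0) (c l) ((Y.submatrix r c).submatrix Fin.succ l.succAbove).det =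
      ∑ p : Fin k, (1 / 2 : ℂ) • (Y (r p.succ) (r 0) *
        ((W.submatrix id l.succAbove).updateRow p
          fun q => Y.submatrix c c l (l.succAbove q)).det +
        Y (r p.succ) (c l) * ((W.submatrix id l.succAbove).updateRow p
          fun q => Y (r 0) (c (l.succAbove q))).det) := by
    intro l
    rw [Derivation.map_det]
    refine Finset.sum_congr rfl fun p _ => ?_
    rw [← Matrix.det_updateRow_smul, ← Matrix.det_updateRow_smul, ← Matrix.det_updateRow_add,
      Algebra.smul_def, ← Matrix.det_updateRow_smul]
    congr 2
    ext q
    simp [hd, Algebra.smul_def]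
  simp only [hdet, Finset.mul_sum]
  rw [Finset.sum_comm]
  have hp : ∀ p : Fin k, ∑ l : Fin (k + 1), (-1) ^ (l : ℕ) *
      ((1 / 2 : ℂ) • (Y (r p.succ) (r 0) *
        ((W.submatrix id l.succAbove).updateRow p
          fun q => Y.submatrix c c l (l.succAbove q)).det +
        Y (r p.succ) (c l) * ((W.submatrix id l.succAbove).updateRow p
          fun q => Y (r 0) (c (l.succAbove q))).det)) =
      -((1 / 2 : ℂ) • (Y.submatrix r c).det) := by
    intro p
    have h1 := sum_det_updateRow_symm W p (Y.submatrix c c) (hY.submatrix c)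
    have h2 := sum_det_updateRow W p (fun l => Y (r p.succ) (c l)) (fun l => Y (r 0) (c l))
    rw [det_cons_updateRow_swap] at h2
    have h3 : consRow (fun l => Y (r 0) (c l)) (W.updateRow p fun l => Y (r p.succ) (c l)) =
        Y.submatrix r c := by
      ext i j
      refine Fin.cases ?_ (fun i => ?_) i
      · simp [consRow_zero]
      · by_cases hi : i = p
        · subst hi; simp [consRow_succ]
        · simp [consRow_succ, Matrix.updateRow_apply, hi, W]
    rw [h3] at h2
    calc _ = (1 / 2 : ℂ) • (Y (r p.succ) (r 0) * ∑ l : Fin (k + 1), (-1) ^ (l : ℕ) *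
        ((W.submatrix id l.succAbove).updateRow p
          fun q => Y.submatrix c c l (l.succAbove q)).det +
        ∑ l : Fin (k + 1), (-1) ^ (l : ℕ) * Y (r p.succ) (c l) *
          ((W.submatrix id l.succAbove).updateRow p
          fun q => Y (r 0) (c (l.succAbove q))).det) := by
          rw [Finset.mul_sum, ← Finset.sum_add_distrib, Finset.smul_sum]
          refine Finset.sum_congr rfl fun l _ => ?_
          rw [mul_smul_comm]
          congr 1
          ring
      _ = _ := by rw [h1, h2, mul_zero, zero_add, smul_neg]
  rw [Finset.sum_congr rfl fun p _ => hp p, Finset.sum_const, Finset.card_univ, Fintype.card_fin,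
    ← Nat.cast_smul_eq_nsmul ℂ, smul_neg, smul_smul]
  congr 2
  ring

/-- The Cayley identity for minors of a symmetric matrix, in terms of its inverse `Y`. -/
theorem cayley_minor (Φ : O →ₐ[ℂ] Module.End ℂ R) (b : Matrix ι ι O)
    (d : ι → ι → Derivation ℂ R R) (Y : Matrix ι ι R) (β : ℂ) (S : Subalgebra ℂ R)
    (hYS : ∀ i j, Y i j ∈ S) (hY : Y.IsSymm)
    (hd : ∀ i j k l, d i j (Y k l) = (1 / 2 : ℂ) • (Y k i * Y j l + Y k j * Y i l))
    (Ψ : ℕ → R)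
    (hb : ∀ i j, ∀ h ∈ S, ∀ m, Φ (b i j) (h * Ψ (m + 1)) = (d i j h - β • (Y i j * h)) * Ψ m)
    (k : ℕ) (r c : Fin k → ι) (m : ℕ) :
    Φ (b.submatrix r c).det (Ψ (m + k)) =
      ((-1) ^ k * ∏ j ∈ Finset.range k, (β + (j : ℂ) / 2)) •
        ((Y.submatrix r c).det * Ψ m) := by
  induction k generalizing m with
  | zero => simp
  | succ k ih =>
    -- In the expansion along the first row the complementary minor of `b` acts before the entry `b
    -- 0 l`. Induction turns it into a minor of `Y`, and `b 0 l` then acts on that minor. Summed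
    -- over `l`, the derivative part gives `-k/2` and the multiplication part `-β`, together the new
    -- factor.
    rw [Matrix.det_succ_row_zero, map_sum, LinearMap.sum_apply]
    have hS : ∀ l : Fin (k + 1), ((Y.submatrix r c).submatrix Fin.succ l.succAbove).det ∈ S := by
      intro l
      rw [Matrix.det_apply]
      refine Subalgebra.sum_mem _ fun τ _ => ?_
      rw [Units.smul_def]
      exact Subalgebra.zsmul_mem _ (Subalgebra.prod_mem _ fun i _ => hYS _ _) _
    have hl : ∀ l : Fin (k + 1), Φ ((-1) ^ (l : ℕ) * (b.submatrix r c) 0 l *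
        ((b.submatrix r c).submatrix Fin.succ l.succAbove).det) (Ψ (m + (k + 1))) =
        ((-1) ^ k * ∏ j ∈ Finset.range k, (β + (j : ℂ) / 2)) •
        ((((-1) ^ (l : ℕ) *
      d (r 0) (c l) ((Y.submatrix r c).submatrix Fin.succ l.succAbove).det) -
        β • ((-1) ^ (l : ℕ) * (Y.submatrix r c) 0 l *
          ((Y.submatrix r c).submatrix Fin.succ l.succAbove).det)) * Ψ m) := by
      intro l
      have h1 := ih (r ∘ Fin.succ) (c ∘ l.succAbove) (m + 1)
      rw [show m + 1 + k = m + (k + 1) by ring] at h1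
      rw [map_mul, Module.End.mul_apply, Matrix.submatrix_submatrix, h1, map_smul, map_mul Φ,
        Module.End.mul_apply, Matrix.submatrix_apply]
      have h2 := hb (r 0) (c l) _ (hS l) m
      rw [Matrix.submatrix_submatrix] at h2
      rw [h2]
      congr 1
      rw [show ((-1 : O) ^ (l : ℕ)) = algebraMap ℂ O ((-1) ^ (l : ℕ)) by simp, AlgHom.commutes,
        Module.algebraMap_end_apply, Algebra.smul_def, map_pow, map_neg, map_one]
      rw [Matrix.submatrix_submatrix, Matrix.submatrix_apply, mul_assoc ((-1) ^ (l : ℕ)),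
        ← mul_smul_comm β ((-1) ^ (l : ℕ)), ← mul_sub, mul_assoc]
    rw [Finset.sum_congr rfl fun l _ => hl l, ← Finset.smul_sum, ← Finset.sum_mul,
      Finset.sum_sub_distrib, ← Finset.smul_sum, sum_derivation_minor d Y hY hd,
      ← Matrix.det_succ_row_zero, Finset.prod_range_succ]
    simp only [Algebra.smul_def, map_mul, map_pow, map_neg, map_one, map_add]
    ring

end Cayley

/-! ### Derivations dual to `Λ` and `Q`, and the second-order operators built from them. -/

section Frame

open Matrix

/-- Commuting derivations on a ring with a symmetric invertible matrix `Λ` and a matrix `Q`, dual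
to the entries of `Λ` and `Q`. -/
structure MomentumFrame (ι κ R : Type*) [Fintype ι] [DecidableEq ι] [Fintype κ] [DecidableEq κ]
    [CommRing R] [Algebra ℂ R] where
  T : Derivation ℂ R R
  σ : ι → ι → Derivation ℂ R R
  τ : ι → κ → Derivation ℂ R R
  Λ : Matrix ι ι R
  Y : Matrix ι ι R
  Q : Matrix ι κ R
  g : Matrix κ κ ℂ
  gi : Matrix κ κ ℂ
  z₀ : R
  Λ_symm : Λ.IsSymm
  Λ_mul_Y : Λ * Y = 1
  g_symm : g.IsSymm
  g_mul_gi : g * gi = 1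
  T_σ : ∀ i j h, T (σ i j h) = σ i j (T h)
  T_Λ : ∀ i j, T (Λ i j) = 0
  T_Q : ∀ i r, T (Q i r) = 0
  T_z₀ : T z₀ = 1
  σ_Λ : ∀ i j k l, σ i j (Λ k l) = -((1 / 2 : ℂ) •
    ((if i = k ∧ j = l then 1 else 0) + (if i = l ∧ j = k then 1 else 0)))
  σ_Q : ∀ i j k r, σ i j (Q k r) = 0
  σ_z₀ : ∀ i j, σ i j z₀ = 0
  τ_Λ : ∀ i r k l, τ i r (Λ k l) = 0
  τ_Q : ∀ i r k s, τ i r (Q k s) = if i = k ∧ r = s then algebraMap ℂ R (1 / 2) else 0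
  τ_z₀ : ∀ i r, τ i r z₀ = 0

namespace MomentumFrame

variable {ι κ R : Type*} [Fintype ι] [DecidableEq ι] [Fintype κ] [DecidableEq κ]
    [CommRing R] [Algebra ℂ R] (M : MomentumFrame ι κ R)

theorem Y_mul_Λ : M.Y * M.Λ = 1 := mul_eq_one_comm.mp M.Λ_mul_Y

theorem Y_symm : M.Y.IsSymm := by
  have h : M.Yᵀ * M.Λ = 1 := by
    have := congrArg Matrix.transpose M.Λ_mul_Y
    rwa [transpose_mul, M.Λ_symm, transpose_one] at this
  calc M.Yᵀ = M.Yᵀ * (M.Λ * M.Y) := by rw [M.Λ_mul_Y, Matrix.mul_one]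
    _ = M.Y := by rw [← Matrix.mul_assoc, h, Matrix.one_mul]

theorem derivation_Y (D : Derivation ℂ R R) (p q : ι) :
    D (M.Y p q) = -∑ k, ∑ l, M.Y p k * D (M.Λ k l) * M.Y l q := by
  have h : ∀ k, ∑ l, (M.Λ k l * D (M.Y l q) + M.Y l q * D (M.Λ k l)) = 0 := by
    intro k
    have := congrArg (fun N : Matrix ι ι R => D (N k q)) M.Λ_mul_Y
    simp only [Matrix.mul_apply, map_sum, Derivation.leibniz, smul_eq_mul] at this
    rw [this, Matrix.one_apply]
    split_ifs <;> simp
  have h2 : D (M.Y p q) = ∑ k, M.Y p k * ∑ l, M.Λ k l * D (M.Y l q) := by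
    have h3 : D (M.Y p q) = ∑ l, (M.Y * M.Λ) p l * D (M.Y l q) := by
      rw [M.Y_mul_Λ]; simp [Matrix.one_apply]
    rw [h3]
    simp only [Matrix.mul_apply, Finset.sum_mul, Finset.mul_sum]
    rw [Finset.sum_comm]
    simp only [mul_assoc]
  rw [h2, ← Finset.sum_neg_distrib]
  refine Finset.sum_congr rfl fun k _ => ?_
  have h4 := h k
  rw [Finset.sum_add_distrib] at h4
  rw [eq_neg_of_add_eq_zero_left h4, mul_neg, Finset.mul_sum]
  congr 1
  refine Finset.sum_congr rfl fun l _ => by ring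

theorem T_Y (i j : ι) : M.T (M.Y i j) = 0 := by
  simp [derivation_Y, M.T_Λ]

theorem τ_Y (i : ι) (r : κ) (k l : ι) : M.τ i r (M.Y k l) = 0 := by
  simp [derivation_Y, M.τ_Λ]

theorem sum_ite_and {A : Type*} [AddCommMonoid A] (i j : ι) (f : ι → ι → A) :
    ∑ k, ∑ l, (if i = k ∧ j = l then f k l else 0) = f i j := by
  simp [ite_and]

theorem σ_Y (i j k l : ι) :
    M.σ i j (M.Y k l) = (1 / 2 : ℂ) • (M.Y k i * M.Y j l + M.Y k j * M.Y i l) := by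
  rw [derivation_Y]
  have h : ∀ p q, M.Y k p * M.σ i j (M.Λ p q) * M.Y q l = -((1 / 2 : ℂ) •
      ((if i = p ∧ j = q then M.Y k p * M.Y q l else 0) +
        (if j = p ∧ i = q then M.Y k p * M.Y q l else 0))) := by
    intro p q
    rw [M.σ_Λ, mul_neg, neg_mul, mul_smul_comm, smul_mul_assoc, mul_add, add_mul]
    simp only [and_comm (a := i = q)]
    congr 3 <;> split_ifs <;> simp
  simp only [h, Finset.sum_neg_distrib, ← Finset.smul_sum, Finset.sum_add_distrib, sum_ite_and,
    neg_neg]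

theorem adjugate_Λ : M.Λ.adjugate = M.Λ.det • M.Y := by
  calc M.Λ.adjugate = M.Λ.adjugate * (M.Λ * M.Y) := by rw [M.Λ_mul_Y, Matrix.mul_one]
    _ = _ := by rw [← Matrix.mul_assoc, Matrix.adjugate_mul, Matrix.smul_mul, Matrix.one_mul]

/-- Jacobi's formula: the determinant with one row replaced is a Cramer coordinate, computed by the
adjugate `Λ.det • Y`. -/
theorem derivation_det (D : Derivation ℂ R R) :
    D M.Λ.det = M.Λ.det * ∑ k, ∑ l, D (M.Λ k l) * M.Y l k := by
  rw [Derivation.map_det, Finset.mul_sum]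
  refine Finset.sum_congr rfl fun k _ => ?_
  rw [← Matrix.cramer_transpose_apply, Matrix.cramer_eq_adjugate_mulVec, ← Matrix.adjugate_transpose,
    M.adjugate_Λ, Matrix.mulVec, dotProduct, Finset.mul_sum]
  refine Finset.sum_congr rfl fun l _ => ?_
  simp only [transpose_apply, Matrix.smul_apply, smul_eq_mul]
  ring

theorem T_det : M.T M.Λ.det = 0 := by
  simp [derivation_det, M.T_Λ]

theorem τ_det (i : ι) (r : κ) : M.τ i r M.Λ.det = 0 := by
  simp [derivation_det, M.τ_Λ]

theorem σ_det (i j : ι) : M.σ i j M.Λ.det = -(M.Λ.det * M.Y i j) := by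
  have h : ∀ p q, M.σ i j (M.Λ p q) * M.Y q p = -((1 / 2 : ℂ) •
      ((if i = p ∧ j = q then M.Y q p else 0) + (if j = p ∧ i = q then M.Y q p else 0))) := by
    intro p q
    rw [M.σ_Λ, neg_mul, smul_mul_assoc, add_mul]
    simp only [and_comm (a := i = q)]
    congr 3 <;> split_ifs <;> simp
  rw [derivation_det]
  simp only [h, Finset.sum_neg_distrib, ← Finset.smul_sum, Finset.sum_add_distrib, sum_ite_and]
  rw [M.Y_symm.apply i j, ← two_smul ℂ, smul_smul]
  norm_num

/-- The Gram matrix with entries in `R`. -/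
def gR : Matrix κ κ R := M.g.map (algebraMap ℂ R)

/-- The matrix `Λ⁻¹ Q`. -/
def V : Matrix ι κ R := M.Y * M.Q

/-- The function `Qᵀ Λ⁻¹ Q`. -/
def w : R := ∑ i, ∑ j, M.Y i j * (M.Q * M.gR * M.Qᵀ) i j

/-- The function `z₀ + Qᵀ Λ⁻¹ Q`. -/
def z : R := M.z₀ + M.w

theorem derivation_gR (D : Derivation ℂ R R) (r s : κ) : D (M.gR r s) = 0 := by
  simp [gR]

theorem gR_symm : M.gR.IsSymm := M.g_symm.map _

theorem derivation_QgQ (D : Derivation ℂ R R) (k l : ι) : D ((M.Q * M.gR * M.Qᵀ) k l) =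
    ∑ s, (D (M.Q k s) * (M.Q * M.gR) l s + D (M.Q l s) * (M.Q * M.gR) k s) := by
  have h1 : ∀ k l, (M.Q * M.gR * M.Qᵀ) k l = ∑ s, ∑ t, M.Q k s * M.gR s t * M.Q l t := by
    intro k l
    simp only [Matrix.mul_apply, Finset.sum_mul, transpose_apply]
    rw [Finset.sum_comm]
  have h2 : ∀ s t, D (M.Q k s * M.gR s t * M.Q l t) =
      D (M.Q k s) * (M.Q l t * M.gR t s) + D (M.Q l t) * (M.Q k s * M.gR s t) := by
    intro s t
    simp only [Derivation.leibniz, derivation_gR, smul_eq_mul, M.gR_symm.apply t s]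
    ring
  rw [h1]
  simp only [map_sum, h2, Finset.sum_add_distrib, Matrix.mul_apply, Finset.mul_sum]
  congr 1
  rw [Finset.sum_comm]

theorem T_w : M.T M.w = 0 := by
  simp only [w, map_sum, Derivation.leibniz, T_Y, derivation_QgQ, M.T_Q]
  simp

theorem T_z : M.T M.z = 1 := by
  simp [z, T_w, M.T_z₀]

theorem QgQ_symm : (M.Q * M.gR * M.Qᵀ).IsSymm := by
  rw [Matrix.IsSymm, transpose_mul, transpose_mul, transpose_transpose, M.gR_symm.eq,
    Matrix.mul_assoc]

theorem VgV : M.V * M.gR * M.Vᵀ = M.Y * (M.Q * M.gR * M.Qᵀ) * M.Y := by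
  rw [V, transpose_mul, M.Y_symm.eq]
  simp only [Matrix.mul_assoc]

/-- Only the factor `Λ⁻¹` of `w` is affected by `σ`. Its derivative is symmetrized in `i`, `j`,
which changes nothing because `Y N Y` is symmetric for symmetric `N`. -/
theorem σ_z (i j : ι) : M.σ i j M.z = (M.V * M.gR * M.Vᵀ) i j := by
  have hN := M.QgQ_symm
  have hY := M.Y_symm
  rw [VgV, z, map_add, M.σ_z₀, zero_add, w]
  simp only [map_sum, Derivation.leibniz, σ_Y, derivation_QgQ, M.σ_Q]
  generalize M.Q * M.gR * M.Qᵀ = N at hN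
  have h1 : ∀ a b, (M.Y * N * M.Y) a b = ∑ k, ∑ l, M.Y k a * M.Y b l * N k l := by
    intro a b
    simp only [Matrix.mul_apply, Finset.sum_mul]
    rw [Finset.sum_comm]
    refine Finset.sum_congr rfl fun k _ => Finset.sum_congr rfl fun l _ => ?_
    rw [hY.apply a k, hY.apply l b]
    ring
  have h2 : (M.Y * N * M.Y).IsSymm := by
    rw [Matrix.IsSymm, transpose_mul, transpose_mul, hY.eq, hN.eq, Matrix.mul_assoc]
  have h3 : (M.Y * N * M.Y) i j =
      (1 / 2 : ℂ) • ((M.Y * N * M.Y) i j + (M.Y * N * M.Y) j i) := by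
    rw [h2.apply, ← two_smul ℂ, smul_smul]
    norm_num
  rw [h3, h1, h1, ← Finset.sum_add_distrib, Finset.smul_sum]
  refine Finset.sum_congr rfl fun k _ => ?_
  rw [← Finset.sum_add_distrib, Finset.smul_sum]
  refine Finset.sum_congr rfl fun l _ => ?_
  simp only [zero_mul, add_zero, Finset.sum_const_zero, smul_eq_mul, mul_zero, zero_add,
    mul_smul_comm]
  congr 1
  ring

/-- Together with `σ_z` this yields the eikonal equation `σ_ij z = ∑ (τ_ir z) (g⁻¹)_rs (τ_js z)`,
the source of the cancellation in `heat_apply`. -/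
theorem τ_z (i : ι) (r : κ) : M.τ i r M.z = (M.V * M.gR) i r := by
  have hY := M.Y_symm
  rw [V, Matrix.mul_assoc, z, map_add, M.τ_z₀, zero_add, w]
  simp only [map_sum, Derivation.leibniz, τ_Y, derivation_QgQ, M.τ_Q]
  generalize M.Q * M.gR = N
  have h1 : ∀ k l : ι, ∑ s, ((if i = k ∧ r = s then algebraMap ℂ R (1 / 2) else 0) * N l s
      + (if i = l ∧ r = s then algebraMap ℂ R (1 / 2) else 0) * N k s) =
      (if i = k then algebraMap ℂ R (1 / 2) * N l r else 0) +
        (if i = l then algebraMap ℂ R (1 / 2) * N k r else 0) := by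
    intro k l
    simp only [ite_and, ite_mul, zero_mul, Finset.sum_add_distrib]
    congr 1 <;> split_ifs <;> simp
  simp only [h1, add_zero, smul_eq_mul, mul_add, mul_ite, mul_zero,
    Finset.sum_add_distrib, Finset.sum_ite_eq, Finset.mem_univ, if_true]
  rw [Finset.sum_comm]
  simp only [Finset.sum_ite_eq, Finset.mem_univ, if_true, Matrix.mul_apply]
  rw [← Finset.sum_add_distrib]
  refine Finset.sum_congr rfl fun k _ => ?_
  have h2 : algebraMap ℂ R (1 / 2) + algebraMap ℂ R (1 / 2) = 1 := by
    rw [← map_add]; norm_num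
  rw [hY.apply i k]
  linear_combination M.Y i k * N k r * h2

theorem T_V (i : ι) (r : κ) : M.T (M.V i r) = 0 := by
  simp [V, Matrix.mul_apply, T_Y, M.T_Q]

theorem τ_V (i : ι) (r : κ) (k : ι) (s : κ) :
    M.τ i r (M.V k s) = if r = s then (1 / 2 : ℂ) • M.Y k i else 0 := by
  simp only [V, Matrix.mul_apply, map_sum, Derivation.leibniz, τ_Y, M.τ_Q, smul_zero, add_zero]
  split_ifs with h <;> simp [h, Algebra.smul_def, mul_comm]

/-- The divided powers `Λ.det ^ a * z ^ m / m!`. -/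
noncomputable def Ψ (a m : ℕ) : R := ((m.factorial : ℂ)⁻¹) • (M.Λ.det ^ a * M.z ^ m)

/-- The factorial makes `T` an exact shift of `m`, so powers of `T` can be inserted and removed
without constants. -/
theorem T_Ψ (a m : ℕ) : M.T (M.Ψ a (m + 1)) = M.Ψ a m := by
  have h : (((m + 1).factorial : ℂ)⁻¹) * ((m : ℂ) + 1) = ((m.factorial : ℂ)⁻¹) := by
    rw [Nat.factorial_succ]
    push_cast
    have h1 : (m : ℂ) + 1 ≠ 0 := Nat.cast_add_one_ne_zero m
    field_simp
  rw [Ψ, Ψ, Derivation.map_smul, Derivation.leibniz, Derivation.leibniz_pow,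
    Derivation.leibniz_pow, T_det, T_z, ← h, mul_smul]
  congr 1
  simp [Algebra.smul_def]
  ring

/-- The chain rule, with `ξ` the logarithmic derivative of `Λ.det`. The derivative in `z` is written
as `T`, since `T z = 1` and `T` kills `Λ.det`; this avoids a separate case `m = 0`. -/
theorem derivation_Ψ (D : Derivation ℂ R R) (ξ : R) (hξ : D M.Λ.det = M.Λ.det * ξ) (a m : ℕ) :
    D (M.Ψ a m) = (a : R) * ξ * M.Ψ a m + D M.z * M.T (M.Ψ a m) := by
  simp only [Ψ, Derivation.map_smul, mul_smul_comm, ← smul_add]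
  congr 1
  simp only [Derivation.leibniz, Derivation.leibniz_pow, T_det, T_z, hξ]
  rcases a with _ | a
  · simp; ring
  · simp [pow_succ]; ring

/-- The elements that are killed by `T` and all `τ`. -/
def invariants : Subalgebra ℂ R where
  carrier := {h | M.T h = 0 ∧ ∀ i r, M.τ i r h = 0}
  mul_mem' := fun {a b} ha hb => by
    simp only [Set.mem_ofPred_eq, Derivation.leibniz] at *
    simp [ha.1, hb.1, ha.2, hb.2]
  add_mem' := fun {a b} ha hb => by
    simp only [Set.mem_ofPred_eq, map_add] at *
    simp [ha.1, hb.1, ha.2, hb.2]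
  algebraMap_mem' := fun c => by simp

/-- Both terms produce `h * (V g Vᵀ) i j * T (Ψ a m)`, which cancels. In the remainder, `-a * Y i j`
comes from `σ` acting on `Λ.det ^ a`, and the shift `card κ / 2` comes from `τ i r (V j r) = Y j i /
2` summed over `r`. -/
theorem heat_apply (i j : ι) (h : R) (hh : h ∈ M.invariants) (a m : ℕ) :
    M.T (M.σ i j (h * M.Ψ a (m + 1))) -
      ∑ r, ∑ s, M.gi s r • M.τ i r (M.τ j s (h * M.Ψ a (m + 1))) =
    (M.σ i j h - ((a : ℂ) + (Fintype.card κ : ℂ) / 2) • (M.Y i j * h)) * M.Ψ a m := by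
  obtain ⟨hT, hτ⟩ := hh
  have hTV : M.T ((M.V * M.gR * M.Vᵀ) i j) = 0 := by
    simp only [Matrix.mul_apply, transpose_apply, map_sum, Derivation.leibniz, T_V, derivation_gR]
    simp
  have h1 : M.T (M.σ i j (h * M.Ψ a (m + 1))) =
      (M.σ i j h - (a : R) * M.Y i j * h) * M.Ψ a m +
        h * (M.V * M.gR * M.Vᵀ) i j * M.T (M.Ψ a m) := by
    rw [Derivation.leibniz, M.derivation_Ψ (M.σ i j) (-M.Y i j) (by rw [σ_det]; ring), T_Ψ, σ_z]
    simp only [smul_eq_mul, map_add, Derivation.leibniz, hT, hTV, T_Ψ, T_Y, map_neg, M.T_σ,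
      Derivation.map_natCast, map_zero]
    ring
  -- The inner derivative yields `(V g) j s`, and contraction with `g⁻¹` reduces it to `V j r`.
  have h2 : ∀ r, ∑ s, M.gi s r • M.τ i r (M.τ j s (h * M.Ψ a (m + 1))) =
      M.τ i r (h * M.V j r * M.Ψ a m) := by
    intro r
    simp only [← Derivation.map_smul (M.τ i r)]
    rw [← map_sum]
    congr 1
    have h3 : ∀ s, M.τ j s (h * M.Ψ a (m + 1)) = h * (M.V * M.gR) j s * M.Ψ a m := by
      intro s
      rw [Derivation.leibniz, M.derivation_Ψ (M.τ j s) 0 (by rw [τ_det]; ring), T_Ψ, τ_z, hτ]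
      simp only [smul_eq_mul]
      ring
    have h4 : M.gR * M.gi.map (algebraMap ℂ R) = 1 := by
      rw [gR, ← Matrix.map_mul, M.g_mul_gi]
      simp
    have h5 : M.V j r = ∑ s, (M.V * M.gR) j s * algebraMap ℂ R (M.gi s r) := by
      conv_lhs => rw [← Matrix.mul_one M.V, ← h4, ← Matrix.mul_assoc, Matrix.mul_apply]
      rfl
    rw [h5, Finset.mul_sum, Finset.sum_mul]
    refine Finset.sum_congr rfl fun s _ => ?_
    rw [h3, Algebra.smul_def]
    ring
  have h6 : ∀ r, M.τ i r (h * M.V j r * M.Ψ a m) =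
      (1 / 2 : ℂ) • (h * M.Y i j) * M.Ψ a m +
        h * ((M.V * M.gR) i r * M.V j r) * M.T (M.Ψ a m) := by
    intro r
    rw [Derivation.leibniz, M.derivation_Ψ (M.τ i r) 0 (by rw [τ_det]; ring), τ_z,
      Derivation.leibniz, hτ, τ_V, if_pos rfl, M.Y_symm.apply]
    simp only [smul_eq_mul, Algebra.smul_def]
    ring
  rw [h1]
  simp only [h2, h6, Finset.sum_add_distrib, ← Finset.sum_mul, ← Finset.mul_sum]
  rw [Finset.sum_const, Finset.card_univ, ← Nat.cast_smul_eq_nsmul ℂ, smul_smul,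
    Matrix.mul_apply (M := M.V * M.gR)]
  simp only [transpose_apply, Algebra.smul_def, map_add, map_mul, map_natCast,
    div_eq_mul_inv, one_mul]
  ring

theorem det_heat_apply {L : ℕ} (M : MomentumFrame (Fin L) κ R) {O : Type*} [CommRing O]
    [Algebra ℂ O] (Φ : O →ₐ[ℂ] Module.End ℂ R) (b : Matrix (Fin L) (Fin L) O)
    (hb : ∀ i j x, Φ (b i j) x =
      M.T (M.σ i j x) - ∑ r, ∑ s, M.gi s r • M.τ i r (M.τ j s x)) (a m : ℕ) :
    Φ b.det (M.Ψ a (m + L)) =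
      ((-1) ^ L * ∏ j ∈ Finset.range L, ((a : ℂ) + (Fintype.card κ : ℂ) / 2 + (j : ℂ) / 2)) •
        (M.Y.det * M.Ψ a m) :=
  cayley_minor Φ b M.σ M.Y _ M.invariants (fun i j => ⟨M.T_Y i j, fun k r => M.τ_Y k r i j⟩)
    M.Y_symm M.σ_Y (M.Ψ a) (fun i j h hh m => by rw [hb, M.heat_apply i j h hh]) L id id m

end MomentumFrame

end Frame

/-! ### The frame of an integral family and the functional equation of `y 𝓤 + 𝓕` at natural
exponents. -/

theorem LoopPair.mk_inl_eq_mk_inl {L E : ℕ} (i j k l : Fin L) :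
    (LoopPair.mk i (.inl j) : LoopPair L E) = .mk k (.inl l) ↔
      (i = k ∧ j = l) ∨ (i = l ∧ j = k) := by
  simp [LoopPair.mk]

theorem LoopPair.mk_inl_ne_mk_inr {L E : ℕ} (i j k : Fin L) (r : Fin E) :
    (LoopPair.mk i (.inl j) : LoopPair L E) ≠ .mk k (.inr r) := by
  simp [LoopPair.mk]

theorem LoopPair.mk_inr_eq_mk_inr {L E : ℕ} (i k : Fin L) (r s : Fin E) :
    (LoopPair.mk i (.inr r) : LoopPair L E) = .mk k (.inr s) ↔ i = k ∧ r = s := by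
  simp [LoopPair.mk]

theorem BernsteinSato.locDeriv_comm {K R S : Type*} [CommRing K] [CommRing R] [CommRing S]
    [Algebra K R] [Algebra R S] [Algebra K S] [IsScalarTower K R S] (d₁ d₂ : Derivation K R R)
    (f : R) [IsLocalization.Away f S] (h : ∀ g, d₁ (d₂ g) = d₂ (d₁ g)) (z : S) :
    locDeriv S d₁ f (locDeriv S d₂ f z) = locDeriv S d₂ f (locDeriv S d₁ f z) := by
  have h0 : ⁅locDeriv S d₁ f, locDeriv S d₂ f⁆ = 0 := by
    apply derivation_ext f
    intro p
    simp [Derivation.commutator_apply, locDeriv_algebraMap, h]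
  have h' := congrArg (fun D : Derivation K S S => D z) h0
  simpa [Derivation.commutator_apply, sub_eq_zero] using h'

theorem MvPolynomial.pderiv_comm {σ R : Type*} [CommRing R] (i j : σ)
    (p : MvPolynomial σ R) : pderiv i (pderiv j p) = pderiv j (pderiv i p) := by
  classical
  have hp : ⁅pderiv (R := R) i, pderiv (R := R) j⁆ = 0 := by
    apply derivation_ext
    intro k
    simp only [Derivation.commutator_apply, pderiv_X, Pi.single_apply]
    split_ifs <;> simp
  have h' := congrArg (fun D : Derivation R (MvPolynomial σ R) (MvPolynomial σ R) => D p) hp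
  simpa [Derivation.commutator_apply, sub_eq_zero] using h'

/-- The operator `p(∂)` with constant coefficients. -/
noncomputable def pderivOp {σ : Type*} :
    MvPolynomial σ ℂ →ₐ[ℂ] Module.End ℂ (MvPolynomial σ ℂ) :=
  commAeval (fun i => (MvPolynomial.pderiv i).toLinearMap)
    (fun i j => LinearMap.ext fun p => MvPolynomial.pderiv_comm i j p)

namespace IntegralFamily

open MvPolynomial

variable {L E N : ℕ} (F : IntegralFamily L E N)

/-- A polynomial in the variables `x` as a polynomial in `x` and the additional variable
`X none`. -/
noncomputable abbrev lift : MvPolynomial (Fin N) ℂ →ₐ[ℂ] MvPolynomial (Option (Fin N)) ℂ :=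
  rename some

/-- The homogeneous polynomial `y * 𝓤 + 𝓕`. -/
noncomputable def homLeePomeransky : MvPolynomial (Option (Fin N)) ℂ :=
  X none * lift F.symanzikU + lift F.symanzikF

/-- The ring `ℂ[x, y, 1/𝓤]`. -/
abbrev LocRing : Type := Localization.Away (lift F.symanzikU)

/-- Partial derivatives on `ℂ[x, y, 1/𝓤]`. -/
noncomputable def locPartial (v : Option (Fin N)) : Derivation ℂ F.LocRing F.LocRing :=
  BernsteinSato.locDeriv F.LocRing (pderiv v) (lift F.symanzikU)

/-- The inclusion of `ℂ[x]` into `ℂ[x, y, 1/𝓤]`. -/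
noncomputable def toLoc : MvPolynomial (Fin N) ℂ →ₐ[ℂ] F.LocRing :=
  (IsScalarTower.toAlgHom ℂ (MvPolynomial (Option (Fin N)) ℂ) F.LocRing).comp lift

theorem locPartial_comm (v v' : Option (Fin N)) (z : F.LocRing) :
    F.locPartial v (F.locPartial v' z) = F.locPartial v' (F.locPartial v z) :=
  BernsteinSato.locDeriv_comm (pderiv v) (pderiv v') (lift F.symanzikU)
    (MvPolynomial.pderiv_comm v v') z

/-- Operators with constant coefficients on `ℂ[x, y, 1/𝓤]`. -/
noncomputable def locOp :
    MvPolynomial (Option (Fin N)) ℂ →ₐ[ℂ] Module.End ℂ F.LocRing :=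
  commAeval (fun v => (F.locPartial v).toLinearMap)
    (fun i j => LinearMap.ext fun p => F.locPartial_comm i j p)

theorem locOp_X (v : Option (Fin N)) (z : F.LocRing) : F.locOp (X v) z = F.locPartial v z := by
  rw [locOp, commAeval_X]; rfl

theorem locOp_C (c : ℂ) (z : F.LocRing) : F.locOp (C c) z = c • z := by
  have : F.locOp (C c) = algebraMap ℂ _ c := F.locOp.commutes c
  rw [this, Module.algebraMap_end_apply]

/-- This allows an identity between polynomials to be checked in the localization, where `Λ⁻¹`
exists. -/
theorem algebraMap_pderivOp (p q : MvPolynomial (Option (Fin N)) ℂ) :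
    algebraMap _ F.LocRing (pderivOp p q) = F.locOp p (algebraMap _ F.LocRing q) := by
  induction p using MvPolynomial.induction_on generalizing q with
  | C c =>
    have : pderivOp (σ := Option (Fin N)) (C c) = algebraMap ℂ _ c := pderivOp.commutes c
    rw [locOp_C, this, Module.algebraMap_end_apply, Algebra.smul_def, Algebra.smul_def, map_mul,
      ← IsScalarTower.algebraMap_apply]
  | add p₁ p₂ h₁ h₂ => simp [h₁, h₂]
  | mul_X p v h =>
    rw [map_mul, map_mul, Module.End.mul_apply, Module.End.mul_apply, h, locOp_X, locPartial,
      BernsteinSato.locDeriv_algebraMap, pderivOp, commAeval_X]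
    rfl

section Frame

variable (B : Matrix (LoopPair L E) (Fin N) ℂ)

/-- The derivation dual to the scalar product `t`, up to a multiple of `∂ / ∂ y`. -/
noncomputable def pairDeriv (t : LoopPair L E) : Derivation ℂ F.LocRing F.LocRing :=
  ∑ a, B t a • (F.locPartial (some a) - F.const a • F.locPartial none)

theorem pairDeriv_apply (t : LoopPair L E) (z : F.LocRing) : F.pairDeriv B t z =
    ∑ a, B t a • (F.locPartial (some a) z - F.const a • F.locPartial none z) := by
  have h := map_sum (Derivation.coeFnAddMonoidHom (R := ℂ) (A := F.LocRing) (M := F.LocRing))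
    (fun a => B t a • (F.locPartial (some a) - F.const a • F.locPartial none)) Finset.univ
  have h' := congrFun h z
  rw [Finset.sum_apply] at h'
  exact h'

/-- The symbol of `pairDeriv`. -/
noncomputable def pairSymbol (t : LoopPair L E) : MvPolynomial (Option (Fin N)) ℂ :=
  ∑ a, C (B t a) * (X (some a) - C (F.const a) * X none)

theorem locOp_pairSymbol (t : LoopPair L E) (z : F.LocRing) :
    F.locOp (F.pairSymbol B t) z = F.pairDeriv B t z := by
  simp only [pairSymbol, pairDeriv_apply, map_sum, LinearMap.sum_apply, map_mul,
    Module.End.mul_apply, map_sub, LinearMap.sub_apply, locOp_X, locOp_C, smul_sub]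

theorem locPartial_toLoc_none (p : MvPolynomial (Fin N) ℂ) :
    F.locPartial none (F.toLoc p) = 0 := by
  have : F.toLoc p = algebraMap _ F.LocRing (lift p) := rfl
  rw [this, locPartial, BernsteinSato.locDeriv_algebraMap]
  have h : pderiv none (lift p) = 0 := by
    apply pderiv_eq_zero_of_notMem_vars
    intro h
    obtain ⟨a, -, ha⟩ := Finset.mem_image.mp (vars_rename some p h)
    simp at ha
  rw [h, map_zero]

theorem locPartial_none_y : F.locPartial none (algebraMap (MvPolynomial (Option (Fin N)) ℂ) F.LocRing (X none)) = 1 := by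
  rw [locPartial, BernsteinSato.locDeriv_algebraMap]
  simp

/-- This value is the negative of `pairDeriv` on `J`: the `∂ / ∂ y` term in `pairDeriv` is there so
that `z₀ = y + J` is killed. -/
theorem pairDeriv_y (t : LoopPair L E) :
    F.pairDeriv B t (algebraMap (MvPolynomial (Option (Fin N)) ℂ) F.LocRing (X none)) =
      algebraMap ℂ F.LocRing (-∑ a, B t a * F.const a) := by
  simp only [pairDeriv_apply, locPartial_none_y]
  simp only [locPartial, BernsteinSato.locDeriv_algebraMap]
  simp [Algebra.smul_def]

theorem pairDeriv_linear (t : LoopPair L E) (c : Fin N → ℂ) :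
    F.pairDeriv B t (F.toLoc (∑ a, C (c a) * X a)) =
      algebraMap ℂ F.LocRing (∑ a, B t a * c a) := by
  have h : ∀ a, F.locPartial (some a) (F.toLoc (∑ a, C (c a) * X a)) =
      algebraMap ℂ F.LocRing (c a) := by
    intro a
    have : F.toLoc (∑ a, C (c a) * X a) =
      algebraMap _ F.LocRing (∑ a, C (c a) * X (some a)) := by
      simp [toLoc]
    rw [this, locPartial, BernsteinSato.locDeriv_algebraMap, IsScalarTower.algebraMap_apply ℂ
      (MvPolynomial (Option (Fin N)) ℂ) F.LocRing]
    congr 1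
    simp [pderiv_X, Pi.single_apply]
  simp only [pairDeriv_apply, locPartial_toLoc_none, h]
  simp [Algebra.smul_def]

theorem loopMatrix_symm : F.loopMatrix.IsSymm := by
  ext i j
  have : (LoopPair.mk j (.inl i) : LoopPair L E) = .mk i (.inl j) := by
    rw [LoopPair.mk_inl_eq_mk_inl]; simp
  simp [loopMatrix, this, eq_comm]

theorem det_toLoc_loopMatrix :
    (F.loopMatrix.map F.toLoc).det = algebraMap _ F.LocRing (lift F.symanzikU) := by
  have := AlgHom.map_det F.toLoc F.loopMatrix
  exact this.symm

theorem isUnit_det_toLoc_loopMatrix : IsUnit (F.loopMatrix.map F.toLoc).det := by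
  rw [det_toLoc_loopMatrix]
  exact IsLocalization.Away.algebraMap_isUnit _

variable {B}

theorem sum_mul_coeff (hBA : B * F.coeff = 1) (c : ℂ) (t u : LoopPair L E) :
    ∑ a, B t a * (c * F.coeff a u) = if t = u then c else 0 := by
  have h : ∑ a, B t a * F.coeff a u = if t = u then 1 else 0 := by
    rw [← Matrix.mul_apply, hBA, Matrix.one_apply]
  calc _ = c * ∑ a, B t a * F.coeff a u := by
        rw [Finset.mul_sum]; exact Finset.sum_congr rfl fun a _ => by ring
    _ = _ := by rw [h]; simp

/-- The frame of derivations dual to the scalar products of a complete family. -/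
noncomputable def frame (hBA : B * F.coeff = 1) (hg : F.gram.det ≠ 0) :
    MomentumFrame (Fin L) (Fin E) F.LocRing where
  T := F.locPartial none
  σ i j := F.pairDeriv B (.mk i (.inl j))
  τ i r := F.pairDeriv B (.mk i (.inr r))
  Λ := F.loopMatrix.map F.toLoc
  Y := (F.loopMatrix.map F.toLoc)⁻¹
  Q := F.linearPart.map F.toLoc
  g := F.gram
  gi := F.gram⁻¹
  z₀ := algebraMap (MvPolynomial (Option (Fin N)) ℂ) F.LocRing (X none) + F.toLoc F.constPart
  Λ_symm := F.loopMatrix_symm.map _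
  Λ_mul_Y := Matrix.mul_nonsing_inv _ F.isUnit_det_toLoc_loopMatrix
  g_symm := F.gram_symm
  g_mul_gi := Matrix.mul_nonsing_inv _ (isUnit_iff_ne_zero.mpr hg)
  T_σ i j h := by
    simp only [pairDeriv_apply, map_sum, map_sub, Derivation.map_smul, F.locPartial_comm none]
  T_Λ i j := F.locPartial_toLoc_none _
  T_Q i r := F.locPartial_toLoc_none _
  T_z₀ := by rw [map_add, locPartial_none_y, locPartial_toLoc_none, add_zero]
  σ_Λ i j k l := by
    rw [Matrix.map_apply, loopMatrix, map_neg, map_neg, pairDeriv_linear, F.sum_mul_coeff hBA,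
      Algebra.smul_def]
    simp only [LoopPair.mk_inl_eq_mk_inl]
    congr 1
    -- On the diagonal both Kronecker terms coincide and the two halves add up to the coefficient
    -- `1`; off the diagonal at most one of them is nonzero.
    by_cases hkl : k = l
    · subst hkl
      by_cases h : i = k ∧ j = k
      · have h2 : algebraMap ℂ F.LocRing 2⁻¹ * 2 = 1 := by
          rw [← map_ofNat (algebraMap ℂ F.LocRing) 2, ← map_mul]
          norm_num
        simp [h, one_add_one_eq_two, h2]
      · simp [h]
    · by_cases h1 : i = k ∧ j = l
      · simp [h1, hkl]
      · by_cases h2 : i = l ∧ j = k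
        · simp [h2, hkl, Ne.symm hkl]
        · simp [h1, h2]
  σ_Q i j k r := by
    rw [Matrix.map_apply, linearPart, pairDeriv_linear, F.sum_mul_coeff hBA,
      if_neg (LoopPair.mk_inl_ne_mk_inr _ _ _ _), map_zero]
  σ_z₀ i j := by
    rw [map_add, pairDeriv_y, constPart, pairDeriv_linear, ← map_add]
    simp
  τ_Λ i r k l := by
    rw [Matrix.map_apply, loopMatrix, map_neg, map_neg, pairDeriv_linear, F.sum_mul_coeff hBA,
      if_neg (LoopPair.mk_inl_ne_mk_inr _ _ _ _).symm, map_zero, neg_zero]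
  τ_Q i r k s := by
    rw [Matrix.map_apply, linearPart, pairDeriv_linear, F.sum_mul_coeff hBA]
    simp only [LoopPair.mk_inr_eq_mk_inr]
    split_ifs <;> simp
  τ_z₀ i r := by
    rw [map_add, pairDeriv_y, constPart, pairDeriv_linear, ← map_add]
    simp

/-- Multiplication by `𝓤` turns `Λ⁻¹` into the adjugate. Hence the powers of `y 𝓤 + 𝓕` are `n!`
times `Ψ n n`. -/
theorem det_mul_z_frame (hBA : B * F.coeff = 1) (hg : F.gram.det ≠ 0) :
    (F.frame hBA hg).Λ.det * (F.frame hBA hg).z =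
      algebraMap _ F.LocRing F.homLeePomeransky := by
  set M := F.frame hBA hg with hM
  have h1 : M.Λ.det = algebraMap _ F.LocRing (lift F.symanzikU) := F.det_toLoc_loopMatrix
  have h2 : M.Λ.det = F.toLoc F.symanzikU := h1
  have h3 : F.toLoc F.symanzikF =
      M.Λ.det * M.w + M.Λ.det * F.toLoc F.constPart := by
    rw [symanzikF, map_add, map_mul, h2]
    congr 1
    rw [MomentumFrame.w, ← h2, Finset.mul_sum, map_sum]
    refine Finset.sum_congr rfl fun i _ => ?_
    rw [Finset.mul_sum, map_sum]
    refine Finset.sum_congr rfl fun j _ => ?_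
    have h4 : F.toLoc (F.loopMatrix.adjugate i j) = M.Λ.det * M.Y i j := by
      have := congrArg (fun A => A i j) (AlgHom.map_adjugate F.toLoc F.loopMatrix)
      have h5 : F.toLoc (F.loopMatrix.adjugate i j) = M.Λ.adjugate i j := this
      rw [h5, M.adjugate_Λ]; rfl
    have h6 : F.toLoc (F.linearGram i j) = (M.Q * M.gR * M.Q.transpose) i j := by
      simp only [linearGram, Matrix.mul_apply, map_sum, map_mul, Matrix.transpose_apply,
        Matrix.map_apply]
      have : ∀ c, F.toLoc (C c) = algebraMap ℂ F.LocRing c := fun c => F.toLoc.commutes c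
      simp only [this]
      rfl
    rw [map_mul, h4, h6, mul_assoc]
  have h7 : M.z = algebraMap (MvPolynomial (Option (Fin N)) ℂ) F.LocRing (X none) + F.toLoc F.constPart + M.w := rfl
  have h8 : algebraMap _ F.LocRing (lift F.symanzikF) = F.toLoc F.symanzikF := rfl
  rw [homLeePomeransky, map_add, map_mul, h8, h3, ← h1, h7]
  ring

/-- The symbol of the operators `T σ_ij - ∑ τ_ir G⁻¹_rs τ_js`. -/
noncomputable def heatSymbol (B : Matrix (LoopPair L E) (Fin N) ℂ) :
    Matrix (Fin L) (Fin L) (MvPolynomial (Option (Fin N)) ℂ) := fun i j =>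
  X none * F.pairSymbol B (.mk i (.inl j)) - ∑ r, ∑ s, C (F.gram⁻¹ s r) *
    (F.pairSymbol B (.mk i (.inr r)) * F.pairSymbol B (.mk j (.inr s)))

/-- The relation `hp` for `p` carries the factor `y ^ L`. To use it, write `Ψ (n+1) (n+1)` as `T ^
L` applied to `Ψ (n+1) (n+1+L)`. Then `det b` lowers the index by `L`, the remaining `T` lowers it
once more, and `Y.det` cancels one power of `𝓤`. -/
theorem pderivOp_homLeePomeransky_pow (hBA : B * F.coeff = 1) (hg : F.gram.det ≠ 0)
    (hU : F.symanzikU ≠ 0) (p : MvPolynomial (Option (Fin N)) ℂ)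
    (hp : X none ^ L * p = X none * C F.gram.det * (F.heatSymbol B).det) (n : ℕ) :
    pderivOp p (F.homLeePomeransky ^ (n + 1)) =
      (F.gram.det * (-1) ^ L * ((n : ℂ) + 1) *
        ∏ j ∈ Finset.range L, ((n : ℂ) + 1 + (E : ℂ) / 2 + (j : ℂ) / 2)) •
        F.homLeePomeransky ^ n := by
  have hinj : Function.Injective (algebraMap (MvPolynomial (Option (Fin N)) ℂ) F.LocRing) := by
    apply IsLocalization.injective _ (M := Submonoid.powers (lift F.symanzikU))
    apply powers_le_nonZeroDivisors_of_noZeroDivisors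
    intro h
    exact hU (rename_injective some (Option.some_injective _) (by rw [h, map_zero]))
  apply hinj
  rw [algebraMap_pderivOp, Algebra.smul_def, map_mul, ← IsScalarTower.algebraMap_apply,
    ← Algebra.smul_def, map_pow (algebraMap _ F.LocRing), map_pow (algebraMap _ F.LocRing)]
  set M := F.frame hBA hg with hM
  rw [← F.det_mul_z_frame hBA hg, ← hM]
  have hT : ∀ k m a, F.locOp (X none ^ k) (M.Ψ a (m + k)) = M.Ψ a m := by
    intro k
    induction k with
    | zero => intro m a; simp
    | succ k ih =>
      intro m a
      have h1 : F.locOp (X none) (M.Ψ a (m + k + 1)) = M.Ψ a (m + k) := by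
        rw [locOp_X]; exact M.T_Ψ a (m + k)
      rw [pow_succ, map_mul, Module.End.mul_apply, ← add_assoc, h1, ih]
  have hY : M.T M.Y.det = 0 := by
    have : M.Y.det ∈ M.invariants := by
      rw [Matrix.det_apply]
      refine Subalgebra.sum_mem _ fun τ _ => ?_
      rw [Units.smul_def]
      refine Subalgebra.zsmul_mem _ (Subalgebra.prod_mem _ fun i _ => ?_) _
      exact ⟨M.T_Y _ _, fun k r => M.τ_Y k r _ _⟩
    exact this.1
  have hdet := M.det_heat_apply F.locOp (F.heatSymbol B) (fun i j x => by
    simp only [heatSymbol, map_sub, map_mul, LinearMap.sub_apply, Module.End.mul_apply, locOp_X,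
      locOp_pairSymbol, map_sum, LinearMap.sum_apply, locOp_C]
    rfl) (n + 1) (n + 1)
  have hmain : F.locOp p (M.Ψ (n + 1) (n + 1)) = (F.gram.det * ((-1) ^ L *
      ∏ j ∈ Finset.range L, ((n : ℂ) + 1 + (E : ℂ) / 2 + (j : ℂ) / 2))) •
        (M.Y.det * M.Ψ (n + 1) n) := by
    rw [← hT L (n + 1) (n + 1), ← Module.End.mul_apply, ← map_mul, mul_comm p, hp, map_mul,
      Module.End.mul_apply, hdet, map_smul, map_mul F.locOp, Module.End.mul_apply, locOp_C, map_smul,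
      locOp_X]
    have : F.locPartial none (M.Y.det * M.Ψ (n + 1) (n + 1)) = M.Y.det * M.Ψ (n + 1) n := by
      change M.T _ = _
      rw [Derivation.leibniz, hY, M.T_Ψ]
      simp
    rw [this, smul_smul, mul_comm]
    simp
  have h1 : (M.Λ.det * M.z) ^ (n + 1) = ((n + 1).factorial : ℂ) • M.Ψ (n + 1) (n + 1) := by
    rw [MomentumFrame.Ψ, smul_smul, mul_inv_cancel₀ (by exact_mod_cast (n + 1).factorial_ne_zero),
      one_smul, mul_pow]
  have h2 : ((n + 1).factorial : ℂ) • (M.Y.det * M.Ψ (n + 1) n) =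
      ((n : ℂ) + 1) • (M.Λ.det * M.z) ^ n := by
    have h3 : M.Λ.det * M.Y.det = 1 := by rw [← Matrix.det_mul, M.Λ_mul_Y, Matrix.det_one]
    rw [MomentumFrame.Ψ, mul_smul_comm, smul_smul, Nat.factorial_succ, Nat.cast_mul, mul_assoc,
      mul_inv_cancel₀ (by exact_mod_cast n.factorial_ne_zero), mul_one]
    push_cast
    congr 1
    rw [mul_pow, pow_succ]
    linear_combination M.Λ.det ^ n * M.z ^ n * h3
  rw [h1, map_smul, hmain, smul_comm, h2, smul_smul]
  congr 1
  ring

end Frame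

end IntegralFamily

/-! ### Specialization at natural exponents, and lifting identities from `s = n` to formal `s`. -/

namespace BernsteinSato

open Polynomial

variable {N : ℕ} {f : MvPolynomial (Fin N) ℂ}

section Evaluation

theorem map_eval_map_C (c : ℂ) (g : MvPolynomial (Fin N) ℂ) :
    MvPolynomial.map (evalRingHom c) (MvPolynomial.map Polynomial.C g) = g := by
  rw [MvPolynomial.map_map]
  have : (evalRingHom c).comp (Polynomial.C : ℂ →+* ℂ[X]) = RingHom.id ℂ := by
    ext; simp
  rw [this, MvPolynomial.map_id]

/-- The specialization `s = c` of the coefficients of `f ^ s`. -/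
noncomputable def evalPow (hf : f ≠ 0) (c : ℂ) :
    PowModule f →+* FractionRing (MvPolynomial (Fin N) ℂ) :=
  IsLocalization.Away.lift (MvPolynomial.map (Polynomial.C : ℂ →+* ℂ[X]) f)
    (g := (algebraMap (MvPolynomial (Fin N) ℂ) (FractionRing (MvPolynomial (Fin N) ℂ))).comp
      (MvPolynomial.map (evalRingHom c))) (by
      rw [RingHom.comp_apply, map_eval_map_C, isUnit_iff_ne_zero]
      simpa using hf)

theorem evalPow_toPow (hf : f ≠ 0) (c : ℂ) (p : MvPolynomial (Fin N) ℂ[X]) :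
    evalPow hf c (toPow f p) = algebraMap _ _ (MvPolynomial.map (evalRingHom c) p) :=
  IsLocalization.Away.lift_eq _ _ p

theorem evalPow_base (hf : f ≠ 0) (c : ℂ) : evalPow hf c (base f) = algebraMap _ _ f := by
  rw [base, evalPow_toPow, map_eval_map_C]

theorem algebraMap_ne_zero (hf : f ≠ 0) :
    algebraMap (MvPolynomial (Fin N) ℂ) (FractionRing (MvPolynomial (Fin N) ℂ)) f ≠ 0 := by
  simpa using hf

theorem evalPow_invBase (hf : f ≠ 0) (c : ℂ) :
    evalPow hf c (invBase f) = (algebraMap _ _ f)⁻¹ := by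
  have h := congrArg (evalPow hf c) (base_mul_invBase f)
  rw [map_mul, map_one, evalPow_base] at h
  exact eq_inv_of_mul_eq_one_right h

theorem evalPow_smul (hf : f ≠ 0) (c : ℂ) (b : ℂ[X]) (h : PowModule f) :
    evalPow hf c (b • h) = algebraMap (MvPolynomial (Fin N) ℂ) _ (MvPolynomial.C (b.eval c)) * evalPow hf c h := by
  have : b • h = toPow f (MvPolynomial.C b) * h := by
    rw [Algebra.smul_def, IsScalarTower.algebraMap_apply ℂ[X] (MvPolynomial (Fin N) ℂ[X])]
    rfl
  rw [this, map_mul, evalPow_toPow]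
  simp

theorem exists_frac (h : PowModule f) : ∃ (p : MvPolynomial (Fin N) ℂ[X]) (k : ℕ),
    h = toPow f p * invBase f ^ k := by
  obtain ⟨k, p, hp⟩ := IsLocalization.Away.surj
    (MvPolynomial.map (Polynomial.C : ℂ →+* ℂ[X]) f) h
  refine ⟨p, k, ?_⟩
  rw [toPow, ← hp, mul_assoc, ← mul_pow]
  have := base_mul_invBase f
  rw [base, toPow] at this
  rw [this, one_pow, mul_one]

/-- The polynomials `u n` are the values at `s = n` of the element `h · f ^ s`, for all large
integers `n`. -/
def Interpolates (hf : f ≠ 0) (h : PowModule f) (u : ℕ → MvPolynomial (Fin N) ℂ) : Prop :=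
  ∃ k, ∀ n ≥ k, algebraMap _ (FractionRing (MvPolynomial (Fin N) ℂ)) (u n) =
    evalPow hf n h * algebraMap _ _ f ^ n

variable {hf : f ≠ 0}

theorem Interpolates.add {h h' : PowModule f} {u u' : ℕ → MvPolynomial (Fin N) ℂ}
    (H : Interpolates hf h u) (H' : Interpolates hf h' u') :
    Interpolates hf (h + h') (fun n => u n + u' n) := by
  obtain ⟨k, hk⟩ := H
  obtain ⟨k', hk'⟩ := H'
  refine ⟨max k k', fun n hn => ?_⟩
  rw [map_add, map_add, hk n (le_trans (le_max_left _ _) hn),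
    hk' n (le_trans (le_max_right _ _) hn), add_mul]

theorem Interpolates.smul {h : PowModule f} {u : ℕ → MvPolynomial (Fin N) ℂ}
    (H : Interpolates hf h u) (b : ℂ[X]) :
    Interpolates hf (b • h) (fun n => b.eval (n : ℂ) • u n) := by
  obtain ⟨k, hk⟩ := H
  refine ⟨k, fun n hn => ?_⟩
  beta_reduce
  rw [evalPow_smul, MvPolynomial.smul_eq_C_mul, map_mul, hk n hn, mul_assoc]

theorem Interpolates.xAct {h : PowModule f} {u : ℕ → MvPolynomial (Fin N) ℂ}
    (H : Interpolates hf h u) (i : Fin N) :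
    Interpolates hf (xAct f i h) (fun n => MvPolynomial.X i * u n) := by
  obtain ⟨k, hk⟩ := H
  refine ⟨k, fun n hn => ?_⟩
  rw [BernsteinSato.xAct, LinearMap.mulLeft_apply, map_mul, map_mul, hk n hn, evalPow_toPow,
    MvPolynomial.map_X, mul_assoc]

/-- For `h = p / f ^ k` and `n > k`, the value `u n` is the polynomial `p(n) f ^ (n - k)`. Its
ordinary derivative is the formula `dAct_frac` at `s = n`. -/
theorem Interpolates.dAct {h : PowModule f} {u : ℕ → MvPolynomial (Fin N) ℂ}
    (H : Interpolates hf h u) (i : Fin N) :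
    Interpolates hf (dAct f i h) (fun n => MvPolynomial.pderiv i (u n)) := by
  obtain ⟨K, hK⟩ := H
  obtain ⟨p, k, rfl⟩ := exists_frac h
  -- The bound `k + 1` leaves the exponent `n - k - 1 = m` nonnegative after one differentiation.
  refine ⟨max K (k + 1), fun n hn => ?_⟩
  obtain ⟨m, rfl⟩ := Nat.exists_eq_add_of_le (le_trans (le_max_right _ _) hn)
  have h1 := hK _ (le_trans (le_max_left _ _) hn)
  have hf' := algebraMap_ne_zero hf
  set n := k + 1 + m with hn'
  set q := MvPolynomial.map (evalRingHom (n : ℂ)) p with hq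
  have hu : u n = q * f ^ (m + 1) := by
    apply IsFractionRing.injective (MvPolynomial (Fin N) ℂ)
      (FractionRing (MvPolynomial (Fin N) ℂ))
    rw [h1, map_mul, map_pow, evalPow_toPow, evalPow_invBase, map_mul, map_pow, ← hq,
      show n = k + (m + 1) by omega, pow_add, mul_assoc, ← mul_assoc ((_)⁻¹ ^ k), inv_pow,
      inv_mul_cancel₀ (pow_ne_zero k hf'), one_mul]
  have hc : (X - (k : ℂ[X])).eval (n : ℂ) = (m : ℂ) + 1 := by
    simp [hn']; ring
  have hE : evalPow hf n (base f * toPow f (MvPolynomial.pderiv i p) + (X - (k : ℂ[X])) •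
      (toPow f p * toPow f (MvPolynomial.map Polynomial.C (MvPolynomial.pderiv i f)))) =
      algebraMap _ _ (f * MvPolynomial.pderiv i q +
        MvPolynomial.C ((m : ℂ) + 1) * (q * MvPolynomial.pderiv i f)) := by
    rw [map_add, evalPow_smul, map_mul, map_mul, evalPow_base, evalPow_toPow, evalPow_toPow,
      evalPow_toPow, map_eval_map_C, ← MvPolynomial.pderiv_map, hc]
    simp only [map_add, map_mul, hq]
  have hD : MvPolynomial.pderiv i (q * f ^ (m + 1)) = (f * MvPolynomial.pderiv i q +
      MvPolynomial.C ((m : ℂ) + 1) * (q * MvPolynomial.pderiv i f)) * f ^ m := by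
    rw [Derivation.leibniz, Derivation.leibniz_pow]
    simp
    ring
  beta_reduce
  rw [dAct_frac, hu, hD, map_mul (evalPow hf n), hE, map_pow, evalPow_invBase, hn',
    pow_add _ (k + 1) m, mul_assoc, ← mul_assoc ((_)⁻¹ ^ (k + 1)), inv_pow,
    inv_mul_cancel₀ (pow_ne_zero (k + 1) hf'), one_mul, map_mul, map_pow]

/-- Each coefficient of the numerator is a polynomial in `s` that vanishes at all large integers. -/
theorem Interpolates.eq_zero {h : PowModule f} (H : Interpolates hf h (fun _ => 0)) : h = 0 := by
  obtain ⟨K, hK⟩ := H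
  obtain ⟨p, k, rfl⟩ := exists_frac h
  have hf' := algebraMap_ne_zero hf
  have hp : p = 0 := by
    ext1 m
    rw [MvPolynomial.coeff_zero]
    apply Polynomial.eq_zero_of_infinite_isRoot
    have hsub : (fun n : ℕ => (n : ℂ)) '' Set.Ici K ⊆ {x | (MvPolynomial.coeff m p).IsRoot x} := by
      rintro _ ⟨n, hn, rfl⟩
      have h1 := hK n hn
      rw [map_zero, map_mul, map_pow, evalPow_invBase, evalPow_toPow, eq_comm,
        mul_eq_zero, mul_eq_zero, or_iff_left (pow_ne_zero _ hf'),
        or_iff_left (pow_ne_zero _ (inv_ne_zero hf'))] at h1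
      have h2 : MvPolynomial.map (evalRingHom (n : ℂ)) p = 0 := by simpa using h1
      have h3 := congrArg (MvPolynomial.coeff m) h2
      rwa [MvPolynomial.coeff_map, MvPolynomial.coeff_zero] at h3
    refine Set.Infinite.mono hsub (Set.Infinite.image ?_ (Set.Ici_infinite K))
    exact Nat.cast_injective.injOn
  rw [hp]; simp

theorem Interpolates.unique {h h' : PowModule f} {u : ℕ → MvPolynomial (Fin N) ℂ}
    (H : Interpolates hf h u) (H' : Interpolates hf h' u) : h = h' := by
  have H0 := H.add (H'.smul (-1))
  simp only [eval_neg, eval_one, neg_smul, one_smul, add_neg_cancel] at H0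
  exact add_neg_eq_zero.mp H0.eq_zero

end Evaluation

/-! ### Operators on polynomials, depending on `n`, that come from `A^N[s]`. -/

section Lifts

/-- The generators of the Weyl algebra. -/
noncomputable def weylGen (v : Fin N ⊕ Fin N) : WeylAlgebra ℂ[X] N :=
  RingQuot.mkAlgHom ℂ[X] (WeylRel ℂ[X] N) (FreeAlgebra.ι ℂ[X] v)

theorem act_weylGen (v : Fin N ⊕ Fin N) : act f (weylGen v) = genAct f v := by
  simp [act, weylGen]

/-- The operator `W` specializes to `A n` at `s = n`. -/
def Specializes (hf : f ≠ 0) (W : WeylAlgebra ℂ[X] N)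
    (A : ℕ → Module.End ℂ (MvPolynomial (Fin N) ℂ)) : Prop :=
  ∀ h u, Interpolates hf h u → Interpolates hf (act f W h) (fun n => A n (u n))

variable {hf : f ≠ 0}

theorem Specializes.add {W W' : WeylAlgebra ℂ[X] N}
    {A A' : ℕ → Module.End ℂ (MvPolynomial (Fin N) ℂ)} (H : Specializes hf W A)
    (H' : Specializes hf W' A') : Specializes hf (W + W') (fun n => A n + A' n) := by
  intro h u hu
  rw [map_add]
  exact (H h u hu).add (H' h u hu)

theorem Specializes.mul {W W' : WeylAlgebra ℂ[X] N}
    {A A' : ℕ → Module.End ℂ (MvPolynomial (Fin N) ℂ)} (H : Specializes hf W A)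
    (H' : Specializes hf W' A') : Specializes hf (W * W') (fun n => A n * A' n) := by
  intro h u hu
  rw [map_mul]
  exact H _ _ (H' h u hu)

theorem specializes_algebraMap (b : ℂ[X]) :
    Specializes hf (algebraMap ℂ[X] _ b) (fun n => algebraMap ℂ _ (b.eval (n : ℂ))) := by
  intro h u hu
  rw [AlgHom.commutes, Module.algebraMap_end_apply]
  simpa only [Module.algebraMap_end_apply] using hu.smul b

theorem specializes_x (i : Fin N) :
    Specializes hf (weylGen (Sum.inl i)) (fun _ => LinearMap.mulLeft ℂ (MvPolynomial.X i)) := by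
  intro h u hu
  rw [act_weylGen]
  exact hu.xAct i

theorem specializes_d (i : Fin N) :
    Specializes hf (weylGen (Sum.inr i)) (fun _ => (MvPolynomial.pderiv i).toLinearMap) := by
  intro h u hu
  rw [act_weylGen]
  exact hu.dAct i

theorem exists_specializes_sum {ι : Type*} (s : Finset ι)
    (A : ι → ℕ → Module.End ℂ (MvPolynomial (Fin N) ℂ))
    (H : ∀ i ∈ s, ∃ W, Specializes hf W (A i)) :
    ∃ W, Specializes hf W (fun n => ∑ i ∈ s, A i n) := by
  classical
  induction s using Finset.induction_on with
  | empty => exact ⟨algebraMap ℂ[X] _ 0, by simpa using specializes_algebraMap (hf := hf) 0⟩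
  | insert a s ha ih =>
    obtain ⟨W, hW⟩ := H a (Finset.mem_insert_self _ _)
    obtain ⟨W', hW'⟩ := ih fun i hi => H i (Finset.mem_insert_of_mem hi)
    refine ⟨W + W', ?_⟩
    simp only [Finset.sum_insert ha]
    exact hW.add hW'

theorem exists_specializes_pderivOp (p : MvPolynomial (Fin N) ℂ) :
    ∃ W, Specializes hf W (fun _ => pderivOp p) := by
  induction p using MvPolynomial.induction_on with
  | C c =>
    refine ⟨algebraMap ℂ[X] _ (Polynomial.C c), ?_⟩
    have h : pderivOp (σ := Fin N) (MvPolynomial.C c) = algebraMap ℂ _ c := pderivOp.commutes c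
    rw [h]
    simpa using specializes_algebraMap (hf := hf) (Polynomial.C c)
  | add p q hp hq =>
    obtain ⟨W, hW⟩ := hp
    obtain ⟨W', hW'⟩ := hq
    exact ⟨W + W', by simpa only [map_add] using hW.add hW'⟩
  | mul_X p i hp =>
    obtain ⟨W, hW⟩ := hp
    refine ⟨W * weylGen (Sum.inr i), ?_⟩
    have h : pderivOp (σ := Fin N) (MvPolynomial.X i) = (MvPolynomial.pderiv i).toLinearMap := by
      rw [pderivOp, commAeval_X]
    rw [map_mul, h]
    exact hW.mul (specializes_d i)

/-- The Euler operator. -/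
noncomputable def eulerOp (N : ℕ) : Module.End ℂ (MvPolynomial (Fin N) ℂ) :=
  ∑ a, LinearMap.mulLeft ℂ (MvPolynomial.X a) * (MvPolynomial.pderiv a).toLinearMap

/-- The product of the operators `d - i - θ` for `i < m`, with the Euler operator `θ`. -/
noncomputable def eulerChain (N : ℕ) (d : ℂ) : ℕ → Module.End ℂ (MvPolynomial (Fin N) ℂ)
  | 0 => 1
  | m + 1 => (algebraMap ℂ _ (d - m) + algebraMap ℂ _ (-1) * eulerOp N) * eulerChain N d m

theorem exists_specializes_eulerChain (d : ℂ[X]) (m : ℕ) :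
    ∃ W, Specializes hf W (fun n => eulerChain N (d.eval (n : ℂ)) m) := by
  induction m with
  | zero =>
    exact ⟨algebraMap ℂ[X] _ 1, by
      simpa [eulerChain] using specializes_algebraMap (hf := hf) 1⟩
  | succ m ih =>
    obtain ⟨W, hW⟩ := ih
    obtain ⟨W', hW'⟩ : ∃ W, Specializes hf W (fun _ => eulerOp N) :=
      exists_specializes_sum Finset.univ _ fun a _ =>
        ⟨_, (specializes_x a).mul (specializes_d a)⟩
    refine ⟨(algebraMap ℂ[X] _ (d - (m : ℂ[X])) + algebraMap ℂ[X] _ (-1) * W') * W, ?_⟩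
    have h := ((specializes_algebraMap (hf := hf) (d - (m : ℂ[X]))).add
      ((specializes_algebraMap (hf := hf) (-1)).mul hW')).mul hW
    simpa only [eval_sub, eval_natCast, eval_neg, eval_one, eulerChain] using h

/-- Both sides of the functional equation interpolate the same polynomials, so `Interpolates.unique`
identifies them over formal `s`. -/
theorem functionalEquation_of_specializes {W : WeylAlgebra ℂ[X] N}
    {A : ℕ → Module.End ℂ (MvPolynomial (Fin N) ℂ)} (H : Specializes hf W A) (b : ℂ[X])
    (hA : ∀ n : ℕ, A n (f ^ (n + 1)) = b.eval (n : ℂ) • f ^ n) : FunctionalEquation f W b := by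
  have h1 : Interpolates hf (base f) (fun n => f ^ (n + 1)) :=
    ⟨0, fun n _ => by rw [evalPow_base, map_pow, pow_succ, mul_comm]⟩
  have h2 : Interpolates hf (1 : PowModule f) (fun n => f ^ n) :=
    ⟨0, fun n _ => by rw [map_one, map_pow, one_mul]⟩
  have h3 := H _ _ h1
  simp only [hA] at h3
  exact h3.unique (h2.smul b)

end Lifts

/-! ### The Bernstein-Sato polynomial as monic generator of an ideal. -/

section Minimal

/-- The polynomials that admit a functional equation. -/
def functionalIdeal (f : MvPolynomial (Fin N) ℂ) : Ideal ℂ[X] where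
  carrier := {b | ∃ P, FunctionalEquation f P b}
  add_mem' := by
    rintro a b ⟨P, hP⟩ ⟨Q, hQ⟩
    exact ⟨P + Q, by
      rw [FunctionalEquation, map_add, LinearMap.add_apply, hP, hQ, add_smul]⟩
  zero_mem' := ⟨0, by simp [FunctionalEquation]⟩
  smul_mem' := by
    rintro c b ⟨P, hP⟩
    exact ⟨c • P, by
      rw [FunctionalEquation, map_smul, LinearMap.smul_apply, hP, smul_eq_mul, mul_smul]⟩

theorem IsBernsteinSatoPolynomial.dvd {b c : ℂ[X]} (hb : IsBernsteinSatoPolynomial f b)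
    (hc : c ∈ functionalIdeal f) : b ∣ c := by
  rw [← Polynomial.modByMonic_eq_zero_iff_dvd hb.monic]
  by_contra h
  have hmem : c %ₘ b ∈ functionalIdeal f := by
    have h1 := Polynomial.modByMonic_add_div c b
    rw [eq_sub_of_add_eq h1]
    exact Ideal.sub_mem _ hc (Ideal.mul_mem_right _ _ hb.exists_operator)
  have hlc : (c %ₘ b).leadingCoeff ≠ 0 := leadingCoeff_ne_zero.mpr h
  have h2 := hb.minimal (Polynomial.C (c %ₘ b).leadingCoeff⁻¹ * (c %ₘ b))
    (by rw [Monic, leadingCoeff_mul, leadingCoeff_C, inv_mul_cancel₀ hlc])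
    ((functionalIdeal f).mul_mem_left _ hmem)
  rw [natDegree_C_mul (inv_ne_zero hlc)] at h2
  have h3 := Polynomial.degree_modByMonic_lt c hb.monic
  have h4 := Polynomial.natDegree_lt_natDegree h h3
  omega

theorem existsUnique_isBernsteinSatoPolynomial {c : ℂ[X]} (hc : c ∈ functionalIdeal f)
    (hc0 : c ≠ 0) : ∃! b, IsBernsteinSatoPolynomial f b := by
  classical
  have hex : ∃ d, ∃ b : ℂ[X], b.Monic ∧ b ∈ functionalIdeal f ∧ b.natDegree = d := by
    have hlc : c.leadingCoeff ≠ 0 := leadingCoeff_ne_zero.mpr hc0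
    exact ⟨_, Polynomial.C c.leadingCoeff⁻¹ * c,
      by rw [Monic, leadingCoeff_mul, leadingCoeff_C, inv_mul_cancel₀ hlc],
      (functionalIdeal f).mul_mem_left _ hc, rfl⟩
  obtain ⟨b, hb, hbI, hbd⟩ := Nat.find_spec hex
  have hB : IsBernsteinSatoPolynomial f b :=
    ⟨hb, hbI, fun c hc hcI => by rw [hbd]; exact Nat.find_min' hex ⟨c, hc, hcI, rfl⟩⟩
  refine ⟨b, hB, fun b' hB' => ?_⟩
  exact eq_of_monic_of_associated hB'.monic hB.monic
    (associated_of_dvd_dvd (hB'.dvd hbI) (hB.dvd hB'.exists_operator))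

end Minimal

/-! ### The factor `s + 1`. -/

section TrivialFactor

/-- The elements of `ℂ[s, x, 1/f]` that are multiples of `f` in `ℂ[s, x]` modulo `s + 1`. -/
noncomputable def multiplesModSuccS (f : MvPolynomial (Fin N) ℂ) : Submodule ℂ[X] (PowModule f) where
  carrier := {h | ∃ g k, h = base f * toPow f g + (X + 1 : ℂ[X]) • k}
  add_mem' := by
    rintro _ _ ⟨g, k, rfl⟩ ⟨g', k', rfl⟩
    exact ⟨g + g', k + k', by rw [map_add, smul_add]; ring⟩
  zero_mem' := ⟨0, 0, by simp⟩
  smul_mem' := by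
    rintro c _ ⟨g, k, rfl⟩
    exact ⟨c • g, c • k, by
      rw [smul_add, smul_comm c, Algebra.smul_def c g, map_mul, Algebra.smul_def c (base f * _),
        ← IsScalarTower.algebraMap_apply, mul_left_comm]⟩

/-- At `s = -1` the element `f · f ^ s` is `1`, and differential operators preserve polynomials.
Explicitly, `∂ i (f g f ^ s) = (f ∂ i g + (s + 1) g ∂ i f) f ^ s`. -/
theorem act_mem_multiplesModSuccS (P : WeylAlgebra ℂ[X] N) {h : PowModule f}
    (hh : h ∈ multiplesModSuccS f) : act f P h ∈ multiplesModSuccS f := by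
  obtain ⟨P, rfl⟩ := RingQuot.mkAlgHom_surjective ℂ[X] (WeylRel ℂ[X] N) P
  induction P using FreeAlgebra.induction generalizing h with
  | grade0 c =>
    rw [AlgHom.commutes, AlgHom.commutes, Module.algebraMap_end_apply]
    exact Submodule.smul_mem _ _ hh
  | grade1 v =>
    change act f (weylGen v) h ∈ _
    rw [act_weylGen]
    obtain ⟨g, k, rfl⟩ := hh
    rcases v with i | i
    · refine ⟨MvPolynomial.X i * g, xAct f i k, ?_⟩
      rw [genAct, Sum.elim_inl, map_add, map_smul, map_mul (toPow f), xAct, LinearMap.mulLeft_apply]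
      ring
    · refine ⟨MvPolynomial.pderiv i g,
        toPow f g * partialDeriv f i (base f) + dAct f i k, ?_⟩
      have hg : partialDeriv f i (toPow f g) = toPow f (MvPolynomial.pderiv i g) := by
        simp [partialDeriv, locDeriv_algebraMap]
      rw [genAct, Sum.elim_inr, map_add, map_smul, dAct_apply, Derivation.leibniz, hg, logDeriv]
      have hb := base_mul_invBase f
      simp only [smul_eq_mul, Algebra.smul_def, map_add, map_one]
      linear_combination (algebraMap ℂ[X] (PowModule f) X * partialDeriv f i (base f) *
        toPow f g) * hb
  | mul P Q hP hQ =>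
    rw [map_mul, map_mul]
    exact hP (hQ hh)
  | add P Q hP hQ =>
    rw [map_add, map_add]
    exact Submodule.add_mem _ (hP hh) (hQ hh)

/-- At `s = -1` the constant `b(-1)` becomes a polynomial multiple of `f`; evaluation at the origin
shows that it is zero. -/
theorem X_add_one_dvd_of_functionalEquation (hf : f ≠ 0) (hf0 : MvPolynomial.eval 0 f = 0)
    {P : WeylAlgebra ℂ[X] N} {b : ℂ[X]} (hP : FunctionalEquation f P b) : X + 1 ∣ b := by
  have h1 : base f ∈ multiplesModSuccS f := ⟨1, 0, by simp⟩
  obtain ⟨g, k, hgk⟩ := act_mem_multiplesModSuccS P h1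
  rw [hP] at hgk
  have h2 := congrArg (evalPow hf (-1)) hgk
  rw [evalPow_smul, map_one, mul_one, map_add, map_mul, evalPow_base, evalPow_toPow,
    evalPow_smul] at h2
  simp only [eval_add, eval_X, eval_one, neg_add_cancel, map_zero, zero_mul, add_zero] at h2
  rw [← map_mul] at h2
  have h3 := IsFractionRing.injective (MvPolynomial (Fin N) ℂ) _ h2
  have h4 := congrArg (MvPolynomial.eval 0) h3
  rw [MvPolynomial.eval_C, map_mul, hf0, zero_mul] at h4
  have h5 := Polynomial.dvd_iff_isRoot.mpr h4
  simpa using h5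

end TrivialFactor

end BernsteinSato

/-! ### Degrees of determinants. -/

namespace MvPolynomial

theorem IsHomogeneous.aeval_mul {σ S : Type*} [CommRing S] [Algebra ℂ S] {p : MvPolynomial σ ℂ}
    {k : ℕ} (hp : p.IsHomogeneous k) (x : σ → S) (u : S) :
    MvPolynomial.aeval (fun a => x a * u) p = MvPolynomial.aeval x p * u ^ k := by
  rw [aeval_def, aeval_def, eval₂_eq, eval₂_eq, Finset.sum_mul]
  refine Finset.sum_congr rfl fun d hd => ?_
  rw [hp.degree_eq_sum_deg_support hd]
  simp only [mul_pow]
  rw [Finset.prod_mul_distrib, Finset.prod_pow_eq_pow_sum, mul_assoc]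

theorem isHomogeneous_det {σ n : Type*} [Fintype n] [DecidableEq n]
    (M : Matrix n n (MvPolynomial σ ℂ)) (w : n → ℕ) (h : ∀ i j, (M i j).IsHomogeneous (w i)) :
    M.det.IsHomogeneous (∑ i, w i) := by
  rw [Matrix.det_apply]
  refine IsHomogeneous.sum _ _ _ fun τ _ => ?_
  have h1 : (∏ i, M (τ i) i).IsHomogeneous (∑ i, w i) := by
    rw [← Equiv.sum_comp τ w]
    exact IsHomogeneous.prod _ _ _ fun i _ => h _ _
  rcases Int.units_eq_one_or (Equiv.Perm.sign τ) with h2 | h2 <;> rw [h2]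
  · simpa using h1
  · simpa using h1.neg

theorem totalDegree_det_le {σ n : Type*} [Fintype n] [DecidableEq n]
    (M : Matrix n n (MvPolynomial σ ℂ)) (u v : n → ℕ)
    (h : ∀ i j, (M i j).totalDegree ≤ u i + v j) :
    M.det.totalDegree ≤ ∑ i, u i + ∑ i, v i := by
  rw [Matrix.det_apply]
  refine totalDegree_finsetSum_le fun τ _ => ?_
  have h1 : (∏ i, M (τ i) i).totalDegree ≤ ∑ i, u i + ∑ i, v i := by
    refine (totalDegree_finsetProd _ _).trans ?_
    rw [← Equiv.sum_comp τ u, ← Finset.sum_add_distrib]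
    exact Finset.sum_le_sum fun i _ => h _ _
  rcases Int.units_eq_one_or (Equiv.Perm.sign τ) with h2 | h2 <;> rw [h2]
  · simpa using h1
  · simpa [totalDegree_neg] using h1

end MvPolynomial

/-! ### The homogenized Baikov polynomial as a Schur complement. -/

namespace IntegralFamily

open MvPolynomial

variable {L E N : ℕ} (F : IntegralFamily L E N)

section Homogenization

/-- The homogenization of degree `L + 1` of a polynomial of degree at most `L + 1`. -/
noncomputable def homogenization (L : ℕ) (P : MvPolynomial (Fin N) ℂ) :
    MvPolynomial (Option (Fin N)) ℂ :=
  ∑ k ∈ Finset.range (L + 2), X none ^ (L + 1 - k) * lift (homogeneousComponent k P)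

theorem algebraMap_homogenization {K : Type*} [Field K]
    [Algebra (MvPolynomial (Option (Fin N)) ℂ) K] [Algebra ℂ K]
    [IsScalarTower ℂ (MvPolynomial (Option (Fin N)) ℂ) K] (P : MvPolynomial (Fin N) ℂ)
    (hP : P.totalDegree ≤ L + 1)
    (ht : algebraMap (MvPolynomial (Option (Fin N)) ℂ) K (X none) ≠ 0) :
    algebraMap _ K (homogenization L P) =
      algebraMap (MvPolynomial (Option (Fin N)) ℂ) K (X none) ^ (L + 1) *
      aeval (fun a => algebraMap (MvPolynomial (Option (Fin N)) ℂ) K (X (some a)) *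
        (algebraMap (MvPolynomial (Option (Fin N)) ℂ) K (X none))⁻¹) P := by
  set t := algebraMap (MvPolynomial (Option (Fin N)) ℂ) K (X none) with ht'
  -- The degree bound enters here: components of degree above `L + 1` are absent from the
  -- homogenization.
  have hsum : P = ∑ k ∈ Finset.range (L + 2), homogeneousComponent k P := by
    conv_lhs => rw [← sum_homogeneousComponent P]
    refine Finset.sum_subset (fun k hk => ?_) fun k _ hk => ?_
    · simp only [Finset.mem_range] at *; omega
    · apply homogeneousComponent_eq_zero
      simp only [Finset.mem_range] at hk; omega
  conv_rhs => rw [hsum]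
  rw [homogenization, map_sum, map_sum, Finset.mul_sum]
  refine Finset.sum_congr rfl fun k hk => ?_
  rw [(homogeneousComponent_isHomogeneous k P).aeval_mul, map_mul, map_pow, ← ht']
  have h1 : algebraMap _ K (lift (homogeneousComponent k P)) = aeval (fun a =>
      algebraMap (MvPolynomial (Option (Fin N)) ℂ) K (X (some a))) (homogeneousComponent k P) := by
    have h := MvPolynomial.algHom_ext
      (f := (IsScalarTower.toAlgHom ℂ (MvPolynomial (Option (Fin N)) ℂ) K).comp lift)
      (g := aeval fun a => algebraMap (MvPolynomial (Option (Fin N)) ℂ) K (X (some a)))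
      (fun a => by simp)
    exact DFunLike.congr_fun h (homogeneousComponent k P)
  have h2 : t ^ (L + 1) = t ^ (L + 1 - k) * t ^ k := by
    rw [← pow_add]
    congr 1
    simp only [Finset.mem_range] at hk
    omega
  rw [h1, h2, inv_pow]
  field_simp

variable {B : Matrix (LoopPair L E) (Fin N) ℂ}

/-- The substitution `χ` sends each scalar product to `pairSymbol / y`, hence `D_a` to `x_a / y` and
the Gram determinant to `P (x / y)`. Eliminating the external block leaves `det G` times the
determinant of `S₁ - S₂ G⁻¹ S₂ᵀ`, which is `heatSymbol / y²`. The powers of `y` match because `y ^ L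
* y ^ (L + 1) = y * (y²) ^ L`. -/
theorem algebraMap_homogenization_baikov {K : Type*} [Field K]
    [Algebra (MvPolynomial (Option (Fin N)) ℂ) K] [Algebra ℂ K]
    [IsScalarTower ℂ (MvPolynomial (Option (Fin N)) ℂ) K] (hAB : F.coeff * B = 1)
    (hg : F.gram.det ≠ 0) (P : MvPolynomial (Fin N) ℂ) (hP : F.IsBaikovPolynomial P)
    (hdeg : P.totalDegree ≤ L + 1)
    (ht : algebraMap (MvPolynomial (Option (Fin N)) ℂ) K (X none) ≠ 0) :
    algebraMap (MvPolynomial (Option (Fin N)) ℂ) K (X none ^ L * homogenization L P) =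
      algebraMap _ K (X none * C F.gram.det * (F.heatSymbol B).det) := by
  have hPh := algebraMap_homogenization P hdeg ht
  have hC : ∀ c : ℂ, algebraMap ℂ K c = algebraMap (MvPolynomial (Option (Fin N)) ℂ) K (C c) :=
    fun c => IsScalarTower.algebraMap_apply ℂ (MvPolynomial (Option (Fin N)) ℂ) K c
  generalize algebraMap (MvPolynomial (Option (Fin N)) ℂ) K = ι at hPh hC ht ⊢
  set t := ι (X none) with ht'
  let χ : MvPolynomial (LoopPair L E) ℂ →ₐ[ℂ] K := aeval fun u => ι (F.pairSymbol B u) * t⁻¹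
  have hχ : ∀ a, χ (F.denominator a) = ι (X (some a)) * t⁻¹ := by
    intro a
    have hs : ∑ u, C (F.coeff a u) * F.pairSymbol B u = X (some a) - C (F.const a) * X none := by
      have h1 : ∀ c, ∑ u, F.coeff a u * B u c = if a = c then 1 else 0 := fun c => by
        rw [← Matrix.mul_apply, hAB, Matrix.one_apply]
      simp only [pairSymbol, Finset.mul_sum]
      rw [Finset.sum_comm]
      simp only [← mul_assoc, ← C_mul, ← Finset.sum_mul, ← map_sum, h1]
      simp
    have h2 := congrArg ι hs
    simp only [map_sum, map_mul, map_sub] at h2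
    simp only [χ, denominator, map_add, map_sum, map_mul, aeval_X, algHom_C, hC, ← mul_assoc,
      ← Finset.sum_mul, h2]
    rw [← ht']
    field_simp
    ring
  have hχP : aeval (fun a => ι (X (some a)) * t⁻¹) P = χ F.scalarProduct.det := by
    rw [← hP, comp_aeval_apply]
    simp only [hχ]
  rw [map_mul, map_pow, map_mul, map_mul, hPh, ← ht', hχP, AlgHom.map_det]
  let S₁ : Matrix (Fin L) (Fin L) K := fun i j => ι (F.pairSymbol B (.mk i (.inl j))) * t⁻¹
  let S₂ : Matrix (Fin L) (Fin E) K := fun i r => ι (F.pairSymbol B (.mk i (.inr r))) * t⁻¹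
  have hS₁ : ∀ i j, S₁ i j = ι (F.pairSymbol B (.mk i (.inl j))) * t⁻¹ := fun _ _ => rfl
  have hS₂ : ∀ i r, S₂ i r = ι (F.pairSymbol B (.mk i (.inr r))) * t⁻¹ := fun _ _ => rfl
  let g : Matrix (Fin E) (Fin E) K := F.gram.map (algebraMap ℂ K)
  have hS : χ.mapMatrix F.scalarProduct = Matrix.fromBlocks S₁ S₂ S₂.transpose g := by
    ext p q
    rcases p with i | r <;> rcases q with j | s
    · exact aeval_X (R := ℂ) (fun u => ι (F.pairSymbol B u) * t⁻¹) (.mk i (.inl j))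
    · exact aeval_X (R := ℂ) (fun u => ι (F.pairSymbol B u) * t⁻¹) (.mk i (.inr s))
    · exact aeval_X (R := ℂ) (fun u => ι (F.pairSymbol B u) * t⁻¹) (.mk j (.inr r))
    · exact algHom_C χ (F.gram r s)
  have hgg : g * F.gram⁻¹.map (algebraMap ℂ K) = 1 := by
    rw [← Matrix.map_mul, Matrix.mul_nonsing_inv _ (isUnit_iff_ne_zero.mpr hg)]
    simp
  have hgg' : F.gram⁻¹.map (algebraMap ℂ K) * g = 1 := mul_eq_one_comm.mp hgg
  let _ : Invertible g := ⟨_, hgg', hgg⟩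
  have hinv : ⅟g = F.gram⁻¹.map (algebraMap ℂ K) := rfl
  have hdetg : g.det = ι (C F.gram.det) := by
    rw [← hC]
    exact (RingHom.map_det (algebraMap ℂ K) F.gram).symm
  rw [hS, Matrix.det_fromBlocks₂₂, hdetg, hinv, RingHom.map_det ι]
  have hb : ι.mapMatrix (F.heatSymbol B) =
      (t * t) • (S₁ - S₂ * F.gram⁻¹.map (algebraMap ℂ K) * S₂.transpose) := by
    have hsymm : F.gram⁻¹.IsSymm := F.gram_symm.inv
    ext i j
    simp only [RingHom.mapMatrix_apply, Matrix.map_apply, heatSymbol, map_sub, map_mul, map_sum,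
      Matrix.smul_apply, Matrix.sub_apply, smul_eq_mul, mul_sub, Matrix.mul_apply,
      Matrix.transpose_apply, hS₁, hS₂, Finset.mul_sum, Finset.sum_mul, ← hC]
    rw [← ht']
    congr 1
    · field_simp
    · rw [Finset.sum_comm]
      refine Finset.sum_congr rfl fun s _ => Finset.sum_congr rfl fun r _ => ?_
      rw [hsymm.apply]
      field_simp
  rw [hb, Matrix.det_smul, Fintype.card_fin]
  ring

theorem homogenization_baikov (hAB : F.coeff * B = 1) (hg : F.gram.det ≠ 0)
    (P : MvPolynomial (Fin N) ℂ) (hP : F.IsBaikovPolynomial P) (hdeg : P.totalDegree ≤ L + 1) :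
    X none ^ L * homogenization L P = X none * C F.gram.det * (F.heatSymbol B).det := by
  have hinj := IsFractionRing.injective (MvPolynomial (Option (Fin N)) ℂ)
    (FractionRing (MvPolynomial (Option (Fin N)) ℂ))
  apply hinj
  refine F.algebraMap_homogenization_baikov hAB hg P hP hdeg fun h => ?_
  exact X_ne_zero (R := ℂ) none (hinj (by rw [h, map_zero]))

end Homogenization

/-! ### Setting `y = 1`, and homogeneity of `𝓤` and `𝓕`. -/

section Dehomogenization

/-- The substitution `y = 1`. -/
noncomputable def atOne : MvPolynomial (Option (Fin N)) ℂ →ₐ[ℂ] MvPolynomial (Fin N) ℂ :=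
  aeval fun o => o.elim 1 X

theorem atOne_lift (p : MvPolynomial (Fin N) ℂ) : atOne (lift p) = p := by
  rw [atOne, lift, aeval_rename]
  exact aeval_X_left_apply p

theorem atOne_X_none : atOne (X none : MvPolynomial (Option (Fin N)) ℂ) = 1 := by
  simp [atOne]

theorem atOne_homLeePomeransky : atOne F.homLeePomeransky = F.leePomeransky := by
  rw [homLeePomeransky, map_add, map_mul, atOne_lift, atOne_lift, atOne_X_none, one_mul,
    leePomeransky]

theorem atOne_pderiv_some (a : Fin N) (p : MvPolynomial (Option (Fin N)) ℂ) :
    atOne (pderiv (some a) p) = pderiv a (atOne p) := by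
  classical
  induction p using MvPolynomial.induction_on with
  | C c => simp [atOne]
  | add p q hp hq => simp [hp, hq]
  | mul_X p v hp =>
    rw [Derivation.leibniz, map_add, smul_eq_mul, smul_eq_mul, map_mul, map_mul, map_mul, hp,
      Derivation.leibniz, smul_eq_mul, smul_eq_mul]
    congr 2
    cases v with
    | none => simp [atOne]
    | some b =>
      simp only [pderiv_X, Pi.single_apply, Option.some_inj, atOne, aeval_X, Option.elim_some]
      split_ifs <;> simp

theorem atOne_pderivOp_lift (q : MvPolynomial (Fin N) ℂ) (p : MvPolynomial (Option (Fin N)) ℂ) :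
    atOne (pderivOp (lift q) p) = pderivOp q (atOne p) := by
  induction q using MvPolynomial.induction_on generalizing p with
  | C c =>
    have h1 : pderivOp (σ := Option (Fin N)) (C c) = algebraMap ℂ _ c := pderivOp.commutes c
    have h2 : pderivOp (σ := Fin N) (C c) = algebraMap ℂ _ c := pderivOp.commutes c
    rw [lift, rename_C, h1, h2, Module.algebraMap_end_apply, Module.algebraMap_end_apply, map_smul]
  | add p₁ p₂ h₁ h₂ => simp only [map_add, LinearMap.add_apply, h₁, h₂]
  | mul_X q a h =>
    have h1 : pderivOp (X (some a) : MvPolynomial (Option (Fin N)) ℂ) p = pderiv (some a) p := by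
      rw [pderivOp, commAeval_X]; rfl
    have h2 : pderivOp (X a : MvPolynomial (Fin N) ℂ) (atOne p) = pderiv a (atOne p) := by
      rw [pderivOp, commAeval_X]; rfl
    rw [map_mul, map_mul, map_mul, Module.End.mul_apply, Module.End.mul_apply, h, lift, rename_X,
      h1, h2, atOne_pderiv_some]

/-- Euler's relation in degree `d` reads `y ∂_y = d - θ`, with `θ` the Euler operator in `x`; at `y
= 1` this expresses `∂_y` through `θ`. Each application lowers the degree by one, hence the factors
`d - i - θ`. -/
theorem atOne_pderiv_none_pow {d : ℕ} {p : MvPolynomial (Option (Fin N)) ℂ}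
    (hp : p.IsHomogeneous d) (m : ℕ) (hm : m ≤ d) :
    (pderivOp (X none ^ m) p).IsHomogeneous (d - m) ∧
      atOne (pderivOp (X none ^ m) p) = BernsteinSato.eulerChain N d m (atOne p) := by
  induction m with
  | zero => simpa [BernsteinSato.eulerChain] using hp
  | succ m ih =>
    obtain ⟨ih1, ih2⟩ := ih (by omega)
    have h1 : pderivOp (X none ^ (m + 1)) p = pderiv none (pderivOp (X none ^ m) p) := by
      rw [pow_succ', map_mul, Module.End.mul_apply]
      generalize pderivOp (X none ^ m) p = q
      rw [pderivOp, commAeval_X]; rfl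
    rw [h1]
    refine ⟨by simpa [Nat.sub_sub] using ih1.pderiv (i := none), ?_⟩
    have h2 := congrArg atOne ih1.sum_X_mul_pderiv
    rw [Fintype.sum_option, map_add, map_mul, atOne_X_none, one_mul, map_sum, map_nsmul] at h2
    simp only [map_mul, atOne_pderiv_some] at h2
    have h3 : ∀ a : Fin N, atOne (X (some a) : MvPolynomial (Option (Fin N)) ℂ) = X a := by
      intro a; simp [atOne]
    simp only [h3] at h2
    rw [BernsteinSato.eulerChain, Module.End.mul_apply, ← ih2, eq_sub_of_add_eq h2]
    generalize atOne (pderivOp (X none ^ m) p) = q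
    rw [LinearMap.add_apply, Module.End.mul_apply, Module.algebraMap_end_apply,
      Module.algebraMap_end_apply, BernsteinSato.eulerOp, LinearMap.sum_apply, neg_one_smul,
      ← Nat.cast_smul_eq_nsmul ℂ, Nat.cast_sub (by omega), sub_eq_add_neg]
    rfl

theorem isHomogeneous_loopMatrix (i j : Fin L) : (F.loopMatrix i j).IsHomogeneous 1 :=
  (IsHomogeneous.sum _ _ _ fun _ _ => isHomogeneous_C_mul_X _ _).neg

theorem isHomogeneous_linearPart (i : Fin L) (r : Fin E) : (F.linearPart i r).IsHomogeneous 1 :=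
  IsHomogeneous.sum _ _ _ fun _ _ => isHomogeneous_C_mul_X _ _

theorem isHomogeneous_symanzikU : F.symanzikU.IsHomogeneous L := by
  have h := isHomogeneous_det F.loopMatrix (fun _ => 1) F.isHomogeneous_loopMatrix
  rwa [Fin.sum_const, smul_eq_mul, mul_one] at h

theorem isHomogeneous_linearGram (i j : Fin L) : (F.linearGram i j).IsHomogeneous 2 := by
  simp only [linearGram, Matrix.mul_apply, Finset.sum_mul]
  refine IsHomogeneous.sum _ _ _ fun r _ => IsHomogeneous.sum _ _ _ fun s _ => ?_
  exact ((F.isHomogeneous_linearPart i s).mul (isHomogeneous_C _ _)).mul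
    (F.isHomogeneous_linearPart j r)

theorem isHomogeneous_symanzikF : F.symanzikF.IsHomogeneous (L + 1) := by
  refine IsHomogeneous.add (IsHomogeneous.sum _ _ _ fun i _ => IsHomogeneous.sum _ _ _ fun j _ => ?_)
    (F.isHomogeneous_symanzikU.mul (IsHomogeneous.sum _ _ _ fun _ _ => isHomogeneous_C_mul_X _ _))
  have h : (F.loopMatrix.adjugate i j).IsHomogeneous (L - 1) := by
    rw [Matrix.adjugate_apply]
    -- The replaced row has constant entries and so weight `0`; the other `L - 1` rows have weight
    -- `1`.
    have := isHomogeneous_det (F.loopMatrix.updateRow j (Pi.single i 1))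
      (fun k => if k = j then 0 else 1) (fun k l => by
        by_cases hk : k = j
        · subst hk
          rw [Matrix.updateRow_self, if_pos rfl, Pi.single_apply]
          split_ifs
          · exact isHomogeneous_one _ _
          · exact isHomogeneous_zero _ _ _
        · rw [Matrix.updateRow_ne hk, if_neg hk]
          exact F.isHomogeneous_loopMatrix k l)
    convert this using 1
    rw [Finset.sum_ite, Finset.sum_const_zero, zero_add, Finset.sum_const, smul_eq_mul, mul_one,
      Finset.filter_ne', Finset.card_erase_of_mem (Finset.mem_univ _), Finset.card_univ,
      Fintype.card_fin]
  have hL : L + 1 = L - 1 + 2 := by have := i.pos; omega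
  rw [hL]
  exact h.mul (F.isHomogeneous_linearGram i j)

theorem isHomogeneous_homLeePomeransky : F.homLeePomeransky.IsHomogeneous (L + 1) := by
  refine IsHomogeneous.add ?_ F.isHomogeneous_symanzikF.rename_isHomogeneous
  rw [add_comm]
  exact (isHomogeneous_X _ _).mul F.isHomogeneous_symanzikU.rename_isHomogeneous

end Dehomogenization

/-! ### Nonvanishing of `𝓤` and `𝓖`, and vanishing of `𝓖` at the origin. -/

section Nonvanishing

theorem eval_loopMatrix (x : Fin N → ℂ) (i j : Fin L) : eval x (F.loopMatrix i j) =
    -((if i = j then 1 else 1 / 2) * ∑ a, x a * F.coeff a (.mk i (.inl j))) := by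
  simp only [loopMatrix, map_neg, map_sum, map_mul, eval_C, eval_X, Finset.mul_sum]
  congr 1
  exact Finset.sum_congr rfl fun a _ => by ring

theorem eval_linearPart (x : Fin N → ℂ) (i : Fin L) (r : Fin E) : eval x (F.linearPart i r) =
    1 / 2 * ∑ a, x a * F.coeff a (.mk i (.inr r)) := by
  simp only [linearPart, map_sum, map_mul, eval_C, eval_X, Finset.mul_sum]
  exact Finset.sum_congr rfl fun a _ => by ring

variable {B : Matrix (LoopPair L E) (Fin N) ℂ}

/-- A complete family has a point with `Λ = 1` and `Q = 0`. -/
theorem exists_eval_eq_one (hBA : B * F.coeff = 1) : ∃ x : Fin N → ℂ,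
    (∀ i j, eval x (F.loopMatrix i j) = (1 : Matrix (Fin L) (Fin L) ℂ) i j) ∧
      ∀ i r, eval x (F.linearPart i r) = 0 := by
  classical
  -- The vector `v` lists the coefficients of `-∑ ℓ_i²`, the sign matching the one in the definition
  -- of `Λ`; invertibility of the coefficient matrix gives `x = v B`.
  let v : LoopPair L E → ℂ := fun t => if ∃ i, t = .mk i (.inl i) then -1 else 0
  have hv : ∀ t, ∑ a, (∑ u, v u * B u a) * F.coeff a t = v t := by
    intro t
    have h : Matrix.vecMul (Matrix.vecMul v B) F.coeff t = v t := by
      rw [Matrix.vecMul_vecMul, hBA, Matrix.vecMul_one]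
    exact h
  refine ⟨fun a => ∑ u, v u * B u a, fun i j => ?_, fun i r => ?_⟩
  · rw [eval_loopMatrix, hv, Matrix.one_apply]
    by_cases hij : i = j
    · subst hij
      have : ∃ k, (LoopPair.mk i (.inl i) : LoopPair L E) = .mk k (.inl k) := ⟨i, rfl⟩
      simp [v, this]
    · have : ¬ ∃ k, (LoopPair.mk i (.inl j) : LoopPair L E) = .mk k (.inl k) := by
        rintro ⟨k, hk⟩
        rw [LoopPair.mk_inl_eq_mk_inl] at hk
        rcases hk with ⟨h1, h2⟩ | ⟨h1, h2⟩ <;> exact hij (h1.trans h2.symm)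
      simp [v, this, hij]
  · rw [eval_linearPart, hv]
    have : ¬ ∃ k, (LoopPair.mk i (.inr r) : LoopPair L E) = .mk k (.inl k) := by
      rintro ⟨k, hk⟩
      exact LoopPair.mk_inl_ne_mk_inr _ _ _ _ hk.symm
    simp [v, this]

theorem symanzikU_ne_zero (hBA : B * F.coeff = 1) : F.symanzikU ≠ 0 := by
  obtain ⟨x, hx, -⟩ := F.exists_eval_eq_one hBA
  intro h
  have h1 : eval x F.symanzikU = 1 := by
    rw [symanzikU, RingHom.map_det]
    have : (eval x).mapMatrix F.loopMatrix = 1 := by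
      ext i j
      exact hx i j
    rw [this, Matrix.det_one]
  rw [h, map_zero] at h1
  exact zero_ne_one h1

theorem eval_mul_of_isHomogeneous (x : Fin N → ℂ) {p : MvPolynomial (Fin N) ℂ} {k : ℕ}
    (hp : p.IsHomogeneous k) (c : ℂ) : eval (fun a => x a * c) p = eval x p * c ^ k := by
  have := hp.aeval_mul x c
  simpa [aeval_eq_eval] using this

/-- `𝓤` and `𝓕` have degrees `L` and `L + 1` and cannot cancel: the scalings by `1` and `2` separate
them. -/
theorem leePomeransky_ne_zero (hBA : B * F.coeff = 1) : F.leePomeransky ≠ 0 := by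
  intro h
  have hU : ∀ x, eval x F.symanzikU = 0 := by
    intro x
    have h1 : ∀ c : ℂ, eval x F.symanzikU * c ^ L + eval x F.symanzikF * c ^ (L + 1) = 0 := by
      intro c
      have := congrArg (eval fun a => x a * c) h
      rwa [leePomeransky, map_add, eval_mul_of_isHomogeneous x F.isHomogeneous_symanzikU,
        eval_mul_of_isHomogeneous x F.isHomogeneous_symanzikF, map_zero] at this
    have h2 := h1 1
    have h3 := h1 2
    have h4 : (2 : ℂ) ^ L ≠ 0 := pow_ne_zero _ two_ne_zero
    have h5 : (2 : ℂ) ^ L * eval x F.symanzikU = 0 := by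
      rw [pow_succ] at h3
      simp only [one_pow, mul_one] at h2
      linear_combination 2 * 2 ^ L * h2 - h3
    exact (mul_eq_zero.mp h5).resolve_left h4
  exact F.symanzikU_ne_zero hBA (MvPolynomial.funext fun x => by rw [hU, map_zero])

theorem eval_zero_leePomeransky (hL : 1 ≤ L) : eval 0 F.leePomeransky = 0 := by
  have h : ∀ {p : MvPolynomial (Fin N) ℂ} {k : ℕ}, p.IsHomogeneous k → 1 ≤ k →
      eval 0 p = 0 := by
    intro p k hp hk
    have := eval_mul_of_isHomogeneous 0 hp 0
    rw [zero_pow (by omega), mul_zero] at this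
    simpa [Pi.zero_def] using this
  rw [leePomeransky, map_add, h F.isHomogeneous_symanzikU hL,
    h F.isHomogeneous_symanzikF (by omega), add_zero]

end Nonvanishing

/-! ### The degree bound for `E = 1` or `L = 1`. -/

section Degree

theorem totalDegree_baikov_le (hA : F.IsComplete) (P : MvPolynomial (Fin N) ℂ)
    (hP : F.IsBaikovPolynomial P) (hEL : E = 1 ∨ L = 1) : P.totalDegree ≤ L + 1 := by
  obtain ⟨B, hAB, -⟩ := hA
  let ψ : MvPolynomial (LoopPair L E) ℂ →ₐ[ℂ] MvPolynomial (Fin N) ℂ :=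
    aeval fun t => ∑ a, C (B t a) * (X a - C (F.const a))
  have h2 : ∀ a, ψ (F.denominator a) = X a := by
    intro a
    have : ∀ c, ∑ t, F.coeff a t * B t c = if a = c then 1 else 0 := fun c => by
      rw [← Matrix.mul_apply, hAB, Matrix.one_apply]
    simp only [ψ, denominator, aeval_X, map_add, map_sum, map_mul, algHom_C,
      MvPolynomial.algebraMap_eq, Finset.mul_sum]
    rw [Finset.sum_comm]
    simp only [← mul_assoc, ← C_mul, ← Finset.sum_mul, ← map_sum, this]
    simp
  have hPψ : P = (ψ.mapMatrix F.scalarProduct).det := by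
    rw [← AlgHom.map_det, ← hP, comp_aeval_apply]
    simp only [h2]
    exact (aeval_X_left_apply P).symm
  have hX : ∀ t, (ψ (X t)).totalDegree ≤ 1 := by
    intro t
    rw [aeval_X]
    refine totalDegree_finsetSum_le fun a _ => ?_
    refine (totalDegree_mul _ _).trans ?_
    rw [totalDegree_C, zero_add]
    refine (totalDegree_sub _ _).trans ?_
    simp
  have hC : ∀ c, (ψ (C c)).totalDegree = 0 := by
    intro c
    rw [algHom_C]
    exact totalDegree_C c
  rw [hPψ]
  rcases hEL with rfl | rfl
  -- For `E = 1` the matrix has `L + 1` rows with entries of degree at most one.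
  · refine (totalDegree_det_le _ (fun _ => 1) (fun _ => 0) ?_).trans (by simp)
    rintro (i | r) (j | s)
    · exact hX _
    · exact hX _
    · exact hX _
    · exact (hC _).le.trans (by simp)
  -- For `L = 1` the external block is constant, so weight one is needed only for the single loop
  -- row and the single loop column, in total `2 = L + 1`.
  · refine (totalDegree_det_le _ (Sum.elim (fun _ => 1) fun _ => 0)
      (Sum.elim (fun _ => 1) fun _ => 0) ?_).trans (by simp)
    rintro (i | r) (j | s)
    · exact (hX _).trans (by simp)
    · exact hX _
    · exact hX _
    · exact (hC _).le

end Degree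

/-! ### The functional equation of `𝓖`. -/

section Main

theorem prod_roots_mem_functionalIdeal (hA : F.IsComplete) (hg : F.gram.det ≠ 0)
    (P : MvPolynomial (Fin N) ℂ) (hP : F.IsBaikovPolynomial P) (hdeg : P.totalDegree ≤ L + 1) :
    ((Polynomial.X + 1) * ∏ j ∈ Finset.Icc 2 (L + 1),
      (Polynomial.X + Polynomial.C (((E : ℂ) + (j : ℂ)) / 2))) ∈
      BernsteinSato.functionalIdeal F.leePomeransky := by
  obtain ⟨B, hAB, hBA⟩ := hA
  have hf := F.leePomeransky_ne_zero hBA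
  set q : Polynomial ℂ := (Polynomial.X + 1) * ∏ j ∈ Finset.Icc 2 (L + 1),
      (Polynomial.X + Polynomial.C (((E : ℂ) + (j : ℂ)) / 2)) with hq
  -- At `s = n` this is the degree of `(y 𝓤 + 𝓕) ^ (n + 1)`. Being polynomial in `s`, it lets the
  -- Euler chains lift to `A^N[s]`.
  let d : Polynomial ℂ := Polynomial.C ((L : ℂ) + 1) * (Polynomial.X + 1)
  obtain ⟨W, hW⟩ := BernsteinSato.exists_specializes_sum (hf := hf) (Finset.range (L + 2))
    (fun k n => pderivOp (homogeneousComponent k P) *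
      BernsteinSato.eulerChain N (d.eval (n : ℂ)) (L + 1 - k))
    (fun k _ => by
      obtain ⟨W, hW⟩ := BernsteinSato.exists_specializes_pderivOp (hf := hf)
        (homogeneousComponent k P)
      obtain ⟨W', hW'⟩ := BernsteinSato.exists_specializes_eulerChain (hf := hf) d (L + 1 - k)
      exact ⟨_, hW.mul hW'⟩)
  have hqn : ∀ n : ℕ, q.eval (n : ℂ) = ((n : ℂ) + 1) *
      ∏ j ∈ Finset.range L, ((n : ℂ) + 1 + (E : ℂ) / 2 + (j : ℂ) / 2) := by
    intro n
    -- The shift of the index by `2` turns `(E + j) / 2` into `1 + E / 2 + j / 2`.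
    have hI : Finset.Icc 2 (L + 1) = Finset.Ico 2 (L + 2) := by
      ext; simp; omega
    rw [hq, hI, Finset.prod_Ico_eq_prod_range, Polynomial.eval_mul, Polynomial.eval_prod]
    simp only [Polynomial.eval_add, Polynomial.eval_X, Polynomial.eval_one, Polynomial.eval_C,
      Nat.add_sub_cancel]
    congr 1
    refine Finset.prod_congr rfl fun j _ => ?_
    push_cast
    ring
  have hFE : BernsteinSato.FunctionalEquation F.leePomeransky W
      (Polynomial.C (F.gram.det * (-1) ^ L) * q) := by
    refine BernsteinSato.functionalEquation_of_specializes hW _ fun n => ?_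
    have hcore := congrArg atOne (F.pderivOp_homLeePomeransky_pow hBA hg
      (F.symanzikU_ne_zero hBA) (homogenization L P)
      (F.homogenization_baikov hAB hg P hP hdeg) n)
    rw [map_smul, map_pow atOne, atOne_homLeePomeransky] at hcore
    have hhom := F.isHomogeneous_homLeePomeransky.pow (n + 1)
    have hsum : atOne (pderivOp (homogenization L P) (F.homLeePomeransky ^ (n + 1))) =
        (∑ k ∈ Finset.range (L + 2), pderivOp (homogeneousComponent k P) *
          BernsteinSato.eulerChain N (d.eval (n : ℂ)) (L + 1 - k)) (F.leePomeransky ^ (n + 1)) := by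
      rw [homogenization, map_sum, LinearMap.sum_apply, LinearMap.sum_apply, map_sum]
      refine Finset.sum_congr rfl fun k _ => ?_
      have hle : L + 1 - k ≤ (L + 1) * (n + 1) :=
        (Nat.sub_le _ _).trans (Nat.le_mul_of_pos_right _ (Nat.succ_pos n))
      have hd : d.eval (n : ℂ) = (((L + 1) * (n + 1) : ℕ) : ℂ) := by
        simp [d]
      rw [mul_comm, map_mul, Module.End.mul_apply, Module.End.mul_apply, atOne_pderivOp_lift,
        (atOne_pderiv_none_pow hhom _ hle).2, map_pow, atOne_homLeePomeransky, hd]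
    rw [← hsum, hcore, Polynomial.eval_mul, Polynomial.eval_C, hqn]
    congr 1
    ring
  have hc : F.gram.det * (-1) ^ L ≠ 0 := mul_ne_zero hg (pow_ne_zero _ (by norm_num))
  have hmem : Polynomial.C (F.gram.det * (-1) ^ L)⁻¹ *
      (Polynomial.C (F.gram.det * (-1) ^ L) * q) ∈
      BernsteinSato.functionalIdeal F.leePomeransky :=
    Ideal.mul_mem_left _ _ ⟨W, hFE⟩
  rwa [← mul_assoc, ← Polynomial.C_mul, inv_mul_cancel₀ hc, Polynomial.C_1, one_mul] at hmem

end Main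

end IntegralFamily

theorem Polynomial.roots_prod_half_integers (L E : ℕ) :
    (∏ j ∈ Finset.Icc 2 (L + 1),
      (Polynomial.X + Polynomial.C (((E : ℂ) + (j : ℂ)) / 2))).roots =
    (Finset.Icc 2 (L + 1)).val.map fun j : ℕ => -(((E : ℂ) + (j : ℂ)) / 2) := by
  rw [← Polynomial.roots_multiset_prod_X_sub_C
    ((Finset.Icc 2 (L + 1)).val.map fun j : ℕ => -(((E : ℂ) + (j : ℂ)) / 2)), Multiset.map_map]
  congr 1
  refine Finset.prod_congr rfl fun j _ => ?_
  simp

theorem mainTheorem12 {L E N : ℕ} (hL : 1 ≤ L) (F : IntegralFamily L E N)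
    (hA : F.IsComplete) (hGr : F.gram.det ≠ 0)
    (P : MvPolynomial (Fin N) ℂ) (hP : F.IsBaikovPolynomial P) :
    (P.totalDegree ≤ L + 1 →
      (∃! b : Polynomial ℂ, BernsteinSato.IsBernsteinSatoPolynomial F.leePomeransky b) ∧
      ∀ b : Polynomial ℂ, BernsteinSato.IsBernsteinSatoPolynomial F.leePomeransky b →
        b ∣ (Polynomial.X + 1) * ∏ j ∈ Finset.Icc 2 (L + 1),
          (Polynomial.X + Polynomial.C (((E : ℂ) + (j : ℂ)) / 2)) ∧
        ∃ c : Polynomial ℂ, b = (Polynomial.X + 1) * c ∧ c.roots.Nodup ∧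
          ∀ z ∈ c.roots, ∃ k : ℤ, z = (k : ℂ) / 2) ∧
    (E = 1 ∨ L = 1 → P.totalDegree ≤ L + 1) := by
  refine ⟨fun hdeg => ?_, F.totalDegree_baikov_le hA P hP⟩
  have hmem := F.prod_roots_mem_functionalIdeal hA hGr P hP hdeg
  have hX1 : (Polynomial.X + 1 : Polynomial ℂ) ≠ 0 := Polynomial.X_add_C_ne_zero 1
  have hprod : (∏ j ∈ Finset.Icc 2 (L + 1),
      (Polynomial.X + Polynomial.C (((E : ℂ) + (j : ℂ)) / 2))) ≠ 0 :=
    Finset.prod_ne_zero_iff.mpr fun j _ => Polynomial.X_add_C_ne_zero _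
  refine ⟨BernsteinSato.existsUnique_isBernsteinSatoPolynomial hmem (mul_ne_zero hX1 hprod),
    fun b hb => ?_⟩
  have hdvd := hb.dvd hmem
  obtain ⟨Q, hQ⟩ := hb.exists_operator
  obtain ⟨B, -, hBA⟩ := hA
  obtain ⟨c, hc⟩ := BernsteinSato.X_add_one_dvd_of_functionalEquation
    (F.leePomeransky_ne_zero hBA) (F.eval_zero_leePomeransky hL) hQ
  -- Cancelling `s + 1` first matters: for `E = 0` the factor with `j = 2` is again `s + 1`, so
  -- simplicity is obtained only for the roots of the quotient `c`.
  have hcdvd := hdvd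
  rw [hc, mul_dvd_mul_iff_left hX1] at hcdvd
  have hroots := Polynomial.roots.le_of_dvd hprod hcdvd
  rw [Polynomial.roots_prod_half_integers] at hroots
  refine ⟨hdvd, c, hc, Multiset.nodup_of_le hroots ?_, fun z hz => ?_⟩
  · refine Multiset.Nodup.map (fun i j hij => ?_) (Finset.Icc 2 (L + 1)).nodup
    have h1 : ((E : ℂ) + i) / 2 = ((E : ℂ) + j) / 2 := neg_injective hij
    have h2 : (i : ℂ) = j := by linear_combination 2 * h1
    exact_mod_cast h2
  · obtain ⟨j, -, rfl⟩ := Multiset.mem_map.mp (Multiset.mem_of_le hroots hz)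
    refine ⟨-((E : ℤ) + j), ?_⟩
    push_cast
    ring
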